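/- Let $n\ge 2$ and $0\le \ell\le n/2$. Write $(z,w)\in\mathbb C^n\times\mathbb C$, $w=u+iv$, $|z|_\ell^2=-\sum_{j\le\ell}|z_j|^2+\sum_{j>\ell}|z_j|^2$ and $\Delta_\ell=-\sum_{j\le\ell}\frac{\partial^2}{\partial z_j\partial\bar z_j}+\sum_{j>\ell}\frac{\partial^2}{\partial z_j\partial\bar z_j}$. Let $M\subset\mathbb C^n\times\mathbb C$ be a smooth ($C^\infty$) real hypersurface and $p\in M$. An *appropriate contact form* at $p$ is a real non-zero linear form $\theta_p$ on $T_pM$ that annihilates $T^{(1,0)}_pM\oplus T^{(0,1)}_pM$ and whose Levi form $L_{\theta_p}(X,Y)=-i\langle d\theta|_p, X\wedge\overline Y\rangle$, $X,Y\in T^{(1,0)}_pM$, has $\ell$ negative and $n-\ell$ positive eigenvalues; here $\theta$ is any smooth 1-form near $p$ that extends $\theta_p$ and annihilates $T^{(1,0)}_qM\oplus T^{(0,1)}_qM$ for all $q\in M$ near $p$. $M$ is *Levi non-degenerate of signature $\ell$* if an appropriate contact form exists at each of its points. **Proposition.** Let $M$ be Levi non-degenerate of signature $\ell$, let $p\in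 M$, and let $\theta_p$ be an appropriate contact form at $p$. Then there is a biholomorphic map $F$ from a neighborhood of $p$ onto a neighborhood of $0$ with $F(p)=0$ such that $F(M)$ is defined near $0$ by $$r=v-|z|_\ell^2+\tfrac14 s(z,\bar z)+R(z,\bar z,u)=0,\qquad s(z,\bar z)=\sum_{\alpha,\beta,\gamma,\delta=1}^n s_{\alpha\bar\beta\gamma\bar\delta}\,z_\alpha\bar z_\beta z_\gamma\bar z_\delta ,$$ where 1. $s_{\alpha\bar\beta\gamma\bar\delta}=s_{\gamma\bar\beta\alpha\bar\delta}=s_{\gamma\bar\delta\alpha\bar\beta}$ and $\overline{s_{\alpha\bar\beta\gamma\bar\delta}}=s_{\beta\bar\alpha\delta\bar\gamma}$; 2. $s$ is trace-free: $\sum_{\alpha,\beta}s_{\alpha\bar\beta\gamma\bar\delta}\,g_0^{\bar\beta\alpha}=0$ for all $\gamma,\delta$, where $g_0^{\bar\beta\alpha}=0$ for $\beta\ne\alpha$, $g_0^{\bar\beta\beta}=-1$ for $\beta\le\ell$ and $g_0^{\bar\beta\beta}=1$ for $\beta>\ell$; equivalently $\Delta_\ell s\equiv 0$; 3. $R$ is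 real-valued and smooth near $0$, $R=o(|(z,u)|^4)$ as $(z,u)\to0$, and $R=o_{wt}(4)$, that is, $R(tz,t\bar z,t^2u)/t^4\to0$ as $t\to0$ in $\mathbb R\setminus\{0\}$, uniformly for $(z,u)$ in compact sets; 4. $i\partial r|_0=(F^{-1})^*\theta_p$ as forms on $T_0F(M)$. -/

import Mathlib

open scoped ContDiff Topology ComplexConjugate

noncomputable section

namespace CRHyp

/-- The space `ℂⁿ × ℂ` with coordinates `(z, w)`. -/
abbrev Cn1 (n : ℕ) : Type := (Fin n → ℂ) × ℂ

/-! ### Real hypersurfaces, tangent spaces, contact forms and the Levi form -/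

/-- `ρ` is a smooth local defining function of `M` near the point `q ∈ M`. -/
def IsLocalDefining {n : ℕ} (M : Set (Cn1 n)) (q : Cn1 n) (ρ : Cn1 n → ℝ) : Prop :=
  ∃ U : Set (Cn1 n), IsOpen U ∧ q ∈ U ∧ ContDiffOn ℝ ∞ ρ U ∧ fderiv ℝ ρ q ≠ 0 ∧
    ∀ x ∈ U, x ∈ M ↔ ρ x = 0

/-- `M` is a smooth (embedded) real hypersurface of `ℂⁿ × ℂ`. -/
def IsSmoothHypersurface {n : ℕ} (M : Set (Cn1 n)) : Prop :=
  ∀ q ∈ M, ∃ ρ : Cn1 n → ℝ, IsLocalDefining M q ρ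

/-- The real tangent space `T_q M`: the common kernel of the differentials at `q` of the local
defining functions of `M` near `q`. (For a hypersurface all these kernels coincide.) -/
def tangentSpaceAt {n : ℕ} (M : Set (Cn1 n)) (q : Cn1 n) : Submodule ℝ (Cn1 n) :=
  ⨅ (ρ : Cn1 n → ℝ) (_ : IsLocalDefining M q ρ), (fderiv ℝ ρ q).toLinearMap.ker

/-- The complex tangent space `T_q M ∩ i T_q M`. A vector `a` of it stands for the vector
`X_a = ∑ a_j ∂/∂z_j = (a - i J a) / 2` of type `(1,0)`, which identifies it with
`T_q^{(1,0)} M`. -/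
def complexTangentSpaceAt {n : ℕ} (M : Set (Cn1 n)) (q : Cn1 n) : Submodule ℂ (Cn1 n) where
  carrier := {x | x ∈ tangentSpaceAt M q ∧ Complex.I • x ∈ tangentSpaceAt M q}
  add_mem' := by
    rintro x y ⟨hx, hx'⟩ ⟨hy, hy'⟩
    refine ⟨add_mem hx hy, ?_⟩
    rw [smul_add]
    exact add_mem hx' hy'
  zero_mem' := ⟨zero_mem _, by rw [smul_zero]; exact zero_mem _⟩
  smul_mem' := by
    rintro c x ⟨hx, hx'⟩
    have key : ∀ c : ℂ, c • x = c.re • x + c.im • (Complex.I • x) := by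
      intro c
      rw [← Complex.coe_smul c.re, ← Complex.coe_smul c.im, smul_smul, ← add_smul,
        Complex.re_add_im]
    refine ⟨?_, ?_⟩
    · rw [key]
      exact add_mem (Submodule.smul_mem _ _ hx) (Submodule.smul_mem _ _ hx')
    · rw [smul_smul, key]
      exact add_mem (Submodule.smul_mem _ _ hx) (Submodule.smul_mem _ _ hx')

/-- `L_θ(X_a, X_b) = -i ⟨dθ|_p, X_a ∧ conj X_b⟩`, with the real 2-form `dθ|_p` extended
complex bilinearly and `X_a = (a - i J a) / 2`, `conj X_b = (b + i J b) / 2`. -/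
def leviForm {n : ℕ} (θ : Cn1 n → Cn1 n [⋀^Fin 1]→L[ℝ] ℝ) (p : Cn1 n) (a b : Cn1 n) : ℂ :=
  -Complex.I * (1 / 4) *
    ((extDeriv θ p ![a, b] : ℂ) + (extDeriv θ p ![Complex.I • a, Complex.I • b] : ℂ)
      + Complex.I * ((extDeriv θ p ![a, Complex.I • b] : ℂ)
        - (extDeriv θ p ![Complex.I • a, b] : ℂ)))

/-- The matrix of the Levi form in a family of vectors of type `(1,0)`. -/
def leviMatrix {n : ℕ} (θ : Cn1 n → Cn1 n [⋀^Fin 1]→L[ℝ] ℝ) (p : Cn1 n)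
    (b : Fin n → Cn1 n) : Matrix (Fin n) (Fin n) ℂ :=
  Matrix.of fun i j => leviForm θ p (b i) (b j)

theorem leviForm_conj {n : ℕ} (θ : Cn1 n → Cn1 n [⋀^Fin 1]→L[ℝ] ℝ) (p : Cn1 n) (a b : Cn1 n) :
    conj (leviForm θ p b a) = leviForm θ p a b := by
  have h : ∀ x y : Cn1 n, extDeriv θ p ![x, y] = -extDeriv θ p ![y, x] := by
    intro x y
    have h1 := (extDeriv θ p).toAlternatingMap.map_swap ![y, x] (i := 0) (j := 1) (by simp)
    have h2 : (![y, x] : Fin 2 → Cn1 n) ∘ Equiv.swap 0 1 = ![x, y] := by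
      ext i : 1
      fin_cases i <;> simp
    rw [h2] at h1
    exact h1
  simp only [leviForm, map_mul, map_add, map_sub, map_neg, Complex.conj_I, Complex.conj_ofReal,
    map_div₀, map_one, map_ofNat]
  rw [h b a, h (Complex.I • b) (Complex.I • a), h b (Complex.I • a), h (Complex.I • b) a]
  push_cast
  ring

theorem leviMatrix_isHermitian {n : ℕ} (θ : Cn1 n → Cn1 n [⋀^Fin 1]→L[ℝ] ℝ) (p : Cn1 n)
    (b : Fin n → Cn1 n) : (leviMatrix θ p b).IsHermitian := by
  ext i j
  exact leviForm_conj θ p (b i) (b j)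

/-- `Θ` is a smooth 1-form near `p` extending `θ` that annihilates the complex tangent space
of `M` at all points of `M` near `p`. -/
def IsContactExtension {n : ℕ} (M : Set (Cn1 n)) (p : Cn1 n) (θ : tangentSpaceAt M p →ₗ[ℝ] ℝ)
    (Θ : Cn1 n → Cn1 n [⋀^Fin 1]→L[ℝ] ℝ) : Prop :=
  (∃ U : Set (Cn1 n), IsOpen U ∧ p ∈ U ∧ ContDiffOn ℝ ∞ Θ U ∧
    ∀ q ∈ M ∩ U, ∀ x ∈ complexTangentSpaceAt M q, Θ q ![x] = 0) ∧
  ∀ x : tangentSpaceAt M p, Θ p ![(x : Cn1 n)] = θ x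

/-- `θ ∈ E_p`: the real covector `θ ≠ 0` on `T_p M` annihilates the complex tangent space, and
the Levi form associated with it, computed with an extension of `θ`, has `ℓ` negative and
`n - ℓ` positive eigenvalues. -/
def IsAppropriateContactForm {n : ℕ} (M : Set (Cn1 n)) (ℓ : ℕ) (p : Cn1 n)
    (θ : tangentSpaceAt M p →ₗ[ℝ] ℝ) : Prop :=
  θ ≠ 0 ∧
  (∀ x : tangentSpaceAt M p, (x : Cn1 n) ∈ complexTangentSpaceAt M p → θ x = 0) ∧
  ∃ Θ : Cn1 n → Cn1 n [⋀^Fin 1]→L[ℝ] ℝ, IsContactExtension M p θ Θ ∧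
    ∃ b : Module.Basis (Fin n) ℂ (complexTangentSpaceAt M p),
      let h := leviMatrix_isHermitian Θ p (fun i => (b i : Cn1 n))
      (Finset.univ.filter fun i => h.eigenvalues i < 0).card = ℓ ∧
      (Finset.univ.filter fun i => 0 < h.eigenvalues i).card = n - ℓ

/-- `M` is Levi non-degenerate of signature `ℓ` at each of its points: for some contact form at
the point, the Levi form has `ℓ` negative and `n - ℓ` positive eigenvalues. -/
def IsLeviNondegenerate {n : ℕ} (M : Set (Cn1 n)) (ℓ : ℕ) : Prop :=
  ∀ q ∈ M, ∃ θ : tangentSpaceAt M q →ₗ[ℝ] ℝ, IsAppropriateContactForm M ℓ q θ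

/-! ### Wirtinger derivatives -/

/-- `(∂f)_x (v)`, the value at `v` of the `(1,0)`-part of the differential of `f`. -/
def del {V : Type*} [NormedAddCommGroup V] [NormedSpace ℝ V] [Module ℂ V]
    (f : V → ℂ) (x v : V) : ℂ :=
  (1 / 2) * (fderiv ℝ f x v - Complex.I * fderiv ℝ f x (Complex.I • v))

/-- `(∂̄f)_x (v)`, the value at `v` of the `(0,1)`-part of the differential of `f`. -/
def delBar {V : Type*} [NormedAddCommGroup V] [NormedSpace ℝ V] [Module ℂ V]
    (f : V → ℂ) (x v : V) : ℂ :=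
  (1 / 2) * (fderiv ℝ f x v + Complex.I * fderiv ℝ f x (Complex.I • v))

/-! ### The normal form -/

/-- The sign `-1` for the first `ℓ` indices and `1` for the others. -/
def sgn {n : ℕ} (ℓ : ℕ) (j : Fin n) : ℂ := if (j : ℕ) < ℓ then -1 else 1

/-- `|z|_ℓ² = -∑_{j ≤ ℓ} |z_j|² + ∑_{j > ℓ} |z_j|²`. -/
def normSqL {n : ℕ} (ℓ : ℕ) (z : Fin n → ℂ) : ℂ := ∑ j, sgn ℓ j * (z j * conj (z j))

/-- `Δ_ℓ f = -∑_{j ≤ ℓ} ∂²f/∂z_j∂z̄_j + ∑_{j > ℓ} ∂²f/∂z_j∂z̄_j`. -/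
def laplacianL {n : ℕ} (ℓ : ℕ) (f : (Fin n → ℂ) → ℂ) (z : Fin n → ℂ) : ℂ :=
  ∑ j, sgn ℓ j * del (fun ζ => delBar f ζ (Pi.single j 1)) z (Pi.single j 1)

/-- `s(z, z̄) = ∑ s_{αβ̄γδ̄} z_α z̄_β z_γ z̄_δ`. -/
def quartic {n : ℕ} (s : Fin n → Fin n → Fin n → Fin n → ℂ) (z : Fin n → ℂ) : ℂ :=
  ∑ α, ∑ β, ∑ γ, ∑ δ, s α β γ δ * (z α * conj (z β) * z γ * conj (z δ))

/-- The inverse matrix `g₀^{β̄α}` of the model Levi form. -/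
def gInv {n : ℕ} (ℓ : ℕ) (β α : Fin n) : ℂ := if β = α then sgn ℓ β else 0

/-- The symmetries and the trace condition of the coefficients `s_{αβ̄γδ̄}`. -/
structure IsChernMoserTensor {n : ℕ} (ℓ : ℕ) (s : Fin n → Fin n → Fin n → Fin n → ℂ) :
    Prop where
  symm_left : ∀ α β γ δ, s α β γ δ = s γ β α δ
  symm_pair : ∀ α β γ δ, s γ β α δ = s γ δ α β
  conj_eq : ∀ α β γ δ, conj (s α β γ δ) = s β α δ γ
  trace_free : ∀ γ δ, ∑ α, ∑ β, s α β γ δ * gInv ℓ β α = 0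

/-- `h = o_wt(k)`: `h(tz, t²u) / t^k → 0` as `t → 0`, uniformly for `(z, u)` in compact sets. -/
def IsLittleOWt {n : ℕ} (k : ℕ) (h : (Fin n → ℂ) × ℝ → ℝ) : Prop :=
  ∀ K : Set ((Fin n → ℂ) × ℝ), IsCompact K →
    TendstoUniformlyOn (fun (t : ℝ) (y : (Fin n → ℂ) × ℝ) => h (t • y.1, t ^ 2 * y.2) / t ^ k)
      (fun _ => 0) (𝓝[≠] 0) K

/-- `r = v - |z|_ℓ² + (1/4) s(z, z̄) + R(z, z̄, u)`, where `w = u + iv`. -/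
def normalForm {n : ℕ} (ℓ : ℕ) (s : Fin n → Fin n → Fin n → Fin n → ℂ)
    (R : (Fin n → ℂ) × ℝ → ℝ) (x : Cn1 n) : ℂ :=
  (x.2.im : ℂ) - normSqL ℓ x.1 + (1 / 4) * quartic s x.1 + (R (x.1, x.2.re) : ℂ)

end CRHyp

end

open CRHyp

/-
The contact form and a Levi-orthonormal frame at `p` provide affine coordinates in which `M` is a
graph `v = φ(z, u)` and `θ_p = du / 2`. A homogeneous real polynomial in `(z, z̄, u)` of degree at
most four can be written as `Im g(z, u) - 2 Re ⟨f(z, u), z⟩_ℓ + Re q(z, z̄)` with `f` and `g`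
holomorphic and `q` of bidegree `(2, 2)`. The changes of coordinates `z ↦ z + f`, `w ↦ w + g`
therefore remove degree after degree everything except `|z|_ℓ²` and `q`: replacing `u` by
`w = u + iv` in `f` and `g` only produces terms of higher order, since `v` has order two on the
graph. Finally `q` is the sum of a trace-free tensor and a product `|z|_ℓ² H(z, z̄)` with `H`
Hermitian, and such a product is removed by a linear rescaling `z ↦ exp(wB) z` with `B` skew for
`⟨·, ·⟩_ℓ`.
-/

noncomputable section

namespace CRHyp

open Filter Asymptotics

/-! ### Order of vanishing and Taylor expansion -/

section Growth

variable {E F G : Type*} [NormedAddCommGroup E] [NormedAddCommGroup F] [NormedAddCommGroup G]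

/-- `f` vanishes to order `k` at the origin, that is, `f = O(‖x‖ ^ k)` as `x → 0`. -/
abbrev VanishesToOrder (k : ℕ) (f : E → F) : Prop := f =O[𝓝 0] fun x => ‖x‖ ^ k

namespace VanishesToOrder

variable {f : E → F} {k m : ℕ}

theorem of_le (hf : VanishesToOrder m f) (hkm : k ≤ m) : VanishesToOrder k f := by
  refine hf.trans ?_
  rcases hkm.eq_or_lt with rfl | hlt
  · exact isBigO_refl _ _
  · exact (isLittleO_norm_pow_norm_pow hlt).isBigO

theorem apply_zero (hf : VanishesToOrder k f) (hk : k ≠ 0) : f 0 = 0 :=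
  IsBigO.eq_zero_of_norm_pow (n := k) (by simpa only [sub_zero] using hf) hk

theorem tendsto_zero (hf : VanishesToOrder k f) (hk : k ≠ 0) : Tendsto f (𝓝 0) (𝓝 0) := by
  refine hf.trans_tendsto ?_
  simpa only [norm_zero, zero_pow hk] using (tendsto_norm_zero (E := E)).pow k

theorem comp {g : G → E} (hf : VanishesToOrder k f) (hg : VanishesToOrder m g) (hm : m ≠ 0) :
    VanishesToOrder (m * k) (f ∘ g) := by
  refine (hf.comp_tendsto (hg.tendsto_zero hm)).trans ?_
  simpa only [Function.comp_def, ← pow_mul] using hg.norm_left.pow k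

theorem mul {R : Type*} [NormedRing R] {f g : E → R}
    (hf : VanishesToOrder k f) (hg : VanishesToOrder m g) :
    VanishesToOrder (k + m) fun x => f x * g x := by
  simpa only [VanishesToOrder, pow_add] using IsBigO.mul hf hg

theorem hasFDerivAt_zero {𝕜 : Type*} [NontriviallyNormedField 𝕜] [NormedSpace 𝕜 E]
    [NormedSpace 𝕜 F] (hf : VanishesToOrder k f) (hk : 1 < k) :
    HasFDerivAt f (0 : E →L[𝕜] F) 0 :=
  IsBigO.hasFDerivAt (n := k) (by simpa only [sub_zero] using hf) hk

theorem of_homogeneous [NormedSpace ℝ E] [NormedSpace ℝ F] (hf : ContinuousAt f 0)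
    (hhom : ∀ (t : ℝ) (x : E), f (t • x) = t ^ k • f x) : VanishesToOrder k f := by
  obtain ⟨r, hr, hball⟩ := Metric.eventually_nhds_iff.1
    (hf.norm.eventually_lt_const (lt_add_one ‖f 0‖))
  refine IsBigO.of_bound ((‖f 0‖ + 1) * (2 / r) ^ k) ?_
  filter_upwards with x
  rcases eq_or_ne x 0 with rfl | hx
  · rcases eq_or_ne k 0 with rfl | hk
    · simp
    · have h0 : f 0 = 0 := by simpa [hk] using hhom 0 0
      simp [h0, hk]
  have : 0 < ‖x‖ := norm_pos_iff.2 hx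
  have hdist : dist ((r / (2 * ‖x‖)) • x) 0 < r := by
    rw [dist_zero_right, norm_smul, Real.norm_of_nonneg (by positivity)]
    field_simp
    linarith
  have hscaled := (hball hdist).le
  rw [hhom, norm_smul, norm_pow, Real.norm_of_nonneg (by positivity)] at hscaled
  calc ‖f x‖ = (r / (2 * ‖x‖)) ^ k * ‖f x‖ * ((2 / r) ^ k * ‖x‖ ^ k) := by
        rw [mul_right_comm, ← mul_pow, ← mul_pow]
        field_simp
        simp
    _ ≤ (‖f 0‖ + 1) * ((2 / r) ^ k * ‖x‖ ^ k) := by gcongr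
    _ = (‖f 0‖ + 1) * (2 / r) ^ k * ‖‖x‖ ^ k‖ := by
        rw [norm_pow, norm_norm, mul_assoc]

theorem eq_zero_of_homogeneous [NormedSpace ℝ E] [NormedSpace ℝ F]
    (hf : VanishesToOrder (k + 1) f) (hhom : ∀ (t : ℝ) (x : E), f (t • x) = t ^ k • f x) (x : E) :
    f x = 0 := by
  have hray : Tendsto (fun t : ℝ => t • x) (𝓝[≠] 0) (𝓝 0) := by
    have hcont : Continuous fun t : ℝ => t • x := by fun_prop
    simpa only [zero_smul] using (hcont.tendsto 0).mono_left nhdsWithin_le_nhds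
  have hpow : (fun t : ℝ => t ^ k • f x) =O[𝓝[≠] 0] fun t => t ^ k * t := by
    refine ((hf.comp_tendsto hray).congr_left fun t => hhom t x).trans ?_
    refine IsBigO.of_bound (‖x‖ ^ (k + 1)) (Eventually.of_forall fun t => le_of_eq ?_)
    simp only [Function.comp_apply, norm_smul, norm_pow, norm_mul, norm_norm]
    ring
  have hconst : (fun _ : ℝ => f x) =O[𝓝[≠] 0] fun t : ℝ => t := by
    obtain ⟨C, hC⟩ := hpow.bound
    refine IsBigO.of_bound C ?_
    filter_upwards [hC, self_mem_nhdsWithin] with t ht ht0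
    rw [norm_smul, norm_mul, mul_left_comm] at ht
    exact le_of_mul_le_mul_left ht (norm_pos_iff.2 (pow_ne_zero k ht0))
  exact tendsto_nhds_unique tendsto_const_nhds
    (hconst.trans_tendsto (tendsto_id.mono_left nhdsWithin_le_nhds))

end VanishesToOrder

end Growth

section Taylor

variable {E F : Type*} [NormedAddCommGroup E] [NormedSpace ℝ E] [NormedAddCommGroup F]
  [NormedSpace ℝ F]

theorem vanishesToOrder_multilinear_diag {𝕜 E F : Type*} [NontriviallyNormedField 𝕜]
    [NormedAddCommGroup E] [NormedSpace 𝕜 E] [NormedAddCommGroup F] [NormedSpace 𝕜 F] {k : ℕ}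
    (m : ContinuousMultilinearMap 𝕜 (fun _ : Fin k => E) F) :
    VanishesToOrder k fun x => m fun _ => x := by
  refine IsBigO.of_bound ‖m‖ (Eventually.of_forall fun x => ?_)
  simpa only [norm_pow, norm_norm, Finset.prod_const, Finset.card_univ, Fintype.card_fin]
    using m.le_opNorm fun _ => x

theorem vanishesToOrder_multilinear_diag_sub {𝕜 E F G : Type*} [NontriviallyNormedField 𝕜]
    [NormedAddCommGroup E] [NormedSpace 𝕜 E] [NormedAddCommGroup F] [NormedSpace 𝕜 F]
    [NormedAddCommGroup G] {d k : ℕ}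
    (m : ContinuousMultilinearMap 𝕜 (fun _ : Fin (d + 1) => E) F) {a b : G → E}
    (ha : VanishesToOrder 1 a) (hb : VanishesToOrder 1 b)
    (hab : VanishesToOrder k fun x => a x - b x) :
    VanishesToOrder (d + k) fun x => (m fun _ => a x) - m fun _ => b x := by
  have hsum : VanishesToOrder 1 fun x => ‖a x‖ + ‖b x‖ := ha.norm_left.add hb.norm_left
  have hprod : VanishesToOrder (d + k) fun x => (‖a x‖ + ‖b x‖) ^ d * ‖a x - b x‖ := by
    refine VanishesToOrder.mul ?_ hab.norm_left
    simpa only [pow_one] using hsum.pow d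
  refine IsBigO.trans (IsBigO.of_bound (‖m‖ * (d + 1)) (Eventually.of_forall fun x => ?_)) hprod
  have hconst (v : E) : ‖fun _ : Fin (d + 1) => v‖ ≤ ‖v‖ := pi_norm_const_le v
  have hmax : max ‖fun _ : Fin (d + 1) => a x‖ ‖fun _ : Fin (d + 1) => b x‖ ≤ ‖a x‖ + ‖b x‖ :=
    max_le ((hconst _).trans (le_add_of_nonneg_right (norm_nonneg _)))
      ((hconst _).trans (le_add_of_nonneg_left (norm_nonneg _)))
  have hdiff : ‖(fun _ : Fin (d + 1) => a x) - fun _ => b x‖ ≤ ‖a x - b x‖ := hconst _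
  rw [Real.norm_of_nonneg (by positivity)]
  calc ‖(m fun _ => a x) - m fun _ => b x‖
      ≤ ‖m‖ * (d + 1 : ℕ) * max ‖fun _ : Fin (d + 1) => a x‖ ‖fun _ : Fin (d + 1) => b x‖ ^ d *
        ‖(fun _ : Fin (d + 1) => a x) - fun _ => b x‖ := by
        simpa using m.norm_image_sub_le (fun _ => a x) fun _ => b x
    _ ≤ ‖m‖ * (d + 1 : ℕ) * (‖a x‖ + ‖b x‖) ^ d * ‖a x - b x‖ := by gcongr
    _ = ‖m‖ * (d + 1) * ((‖a x‖ + ‖b x‖) ^ d * ‖a x - b x‖) := by push_cast; ring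

variable [CompleteSpace F] {f : E → F} {d : ℕ}

theorem norm_taylor_remainder_le {x y : E} {C : ℝ}
    (hf : ∀ t ∈ Set.Icc (0 : ℝ) 1, ContDiffAt ℝ (d + 1) f (x + t • y))
    (hC : ∀ t ∈ Set.Icc (0 : ℝ) 1, ‖iteratedFDeriv ℝ (d + 1) f (x + t • y)‖ ≤ C) :
    ‖f (x + y) - ∑ k ∈ Finset.range (d + 1),
      (k.factorial : ℝ)⁻¹ • iteratedFDeriv ℝ k f x fun _ => y‖ ≤ C * ‖y‖ ^ (d + 1) := by
  have hintegrand : ∀ t ∈ Set.uIoc (0 : ℝ) 1,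
      ‖(1 - t) ^ d • iteratedFDeriv ℝ (d + 1) f (x + t • y) fun _ => y‖ ≤ C * ‖y‖ ^ (d + 1) := by
    intro t ht
    rw [Set.uIoc_of_le zero_le_one] at ht
    have hfactor : ‖(1 - t) ^ d‖ ≤ 1 := by
      rw [norm_pow, Real.norm_of_nonneg (sub_nonneg.2 ht.2)]
      exact pow_le_one₀ (sub_nonneg.2 ht.2) (sub_le_self 1 ht.1.le)
    have hderiv : ‖iteratedFDeriv ℝ (d + 1) f (x + t • y) fun _ => y‖ ≤ C * ‖y‖ ^ (d + 1) := by
      refine ((iteratedFDeriv ℝ (d + 1) f (x + t • y)).le_opNorm _).trans ?_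
      rw [Finset.prod_const, Finset.card_univ, Fintype.card_fin]
      exact mul_le_mul_of_nonneg_right (hC t (Set.Ioc_subset_Icc_self ht)) (by positivity)
    rw [norm_smul]
    exact (mul_le_of_le_one_left (norm_nonneg _) hfactor).trans hderiv
  rw [map_add_eq_sum_add_integral_iteratedFDeriv hf, add_sub_cancel_left, norm_smul, norm_inv,
    RCLike.norm_natCast]
  have hint := intervalIntegral.norm_integral_le_of_norm_le_const hintegrand
  rw [sub_zero, abs_one, mul_one] at hint
  have hfactorial : ((d.factorial : ℝ)⁻¹) ≤ 1 :=
    inv_le_one_of_one_le₀ (by exact_mod_cast d.factorial_pos)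
  exact (mul_le_of_le_one_left (norm_nonneg _) hfactorial).trans hint

theorem vanishesToOrder_taylor_remainder (hf : ContDiffAt ℝ (d + 1) f 0) :
    VanishesToOrder (d + 1) fun y => f y - ∑ k ∈ Finset.range (d + 1),
      (k.factorial : ℝ)⁻¹ • iteratedFDeriv ℝ k f 0 fun _ => y := by
  have hcont : ContinuousAt (iteratedFDeriv ℝ (d + 1) f) 0 :=
    (hf.iteratedFDeriv_right (i := d + 1) (m := 0) (by simp)).continuousAt
  have hbound : ∀ᶠ x in 𝓝 (0 : E),
      ‖iteratedFDeriv ℝ (d + 1) f x‖ < ‖iteratedFDeriv ℝ (d + 1) f 0‖ + 1 :=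
    hcont.norm.eventually (gt_mem_nhds (lt_add_one _))
  obtain ⟨ε, hε, hball⟩ := Metric.eventually_nhds_iff_ball.1 ((hf.eventually (by simp)).and hbound)
  refine IsBigO.of_bound (‖iteratedFDeriv ℝ (d + 1) f 0‖ + 1) ?_
  filter_upwards [Metric.ball_mem_nhds (0 : E) hε] with y hy
  have hsegment : ∀ t ∈ Set.Icc (0 : ℝ) 1, (0 : E) + t • y ∈ Metric.ball (0 : E) ε :=
    fun t ht => (convex_ball (0 : E) ε).add_smul_mem (Metric.mem_ball_self hε)
      (by rwa [zero_add]) ht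
  simpa only [norm_pow, norm_norm, zero_add] using
    norm_taylor_remainder_le (x := 0) (fun t ht => (hball _ (hsegment t ht)).1)
      fun t ht => (hball _ (hsegment t ht)).2.le

theorem iteratedFDeriv_diag_eq_zero (hf : ContDiffAt ℝ d f 0) (hO : VanishesToOrder d f) {k : ℕ}
    (hk : k < d) (y : E) : iteratedFDeriv ℝ k f 0 (fun _ => y) = 0 := by
  induction k using Nat.strong_induction_on generalizing y with
  | _ k ih =>
    have hsmooth : ContDiffAt ℝ (k + 1) f 0 := hf.of_le (by exact_mod_cast hk)
    have hterm : VanishesToOrder (k + 1) fun y =>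
        (k.factorial : ℝ)⁻¹ • iteratedFDeriv ℝ k f 0 fun _ => y := by
      refine (IsBigO.sub (hO.of_le hk)
        (vanishesToOrder_taylor_remainder hsmooth)).congr_left fun y => ?_
      rw [Finset.sum_range_succ, Finset.sum_eq_zero fun j hj => ?_, zero_add, sub_sub_cancel]
      have hj := Finset.mem_range.1 hj
      rw [ih j hj (hj.trans hk), smul_zero]
    have hzero := hterm.eq_zero_of_homogeneous (fun t y => by
      rw [smul_comm]
      congr 1
      simpa using (iteratedFDeriv ℝ k f 0).map_smul_univ (fun _ => t) fun _ => y) y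
    exact (smul_eq_zero.1 hzero).resolve_left (by positivity)

theorem vanishesToOrder_sub_leading_term (hf : ContDiffAt ℝ (d + 1) f 0)
    (hO : VanishesToOrder d f) :
    VanishesToOrder (d + 1) fun y =>
      f y - (d.factorial : ℝ)⁻¹ • iteratedFDeriv ℝ d f 0 fun _ => y := by
  refine (vanishesToOrder_taylor_remainder hf).congr_left fun y => ?_
  rw [Finset.sum_range_succ, Finset.sum_eq_zero fun k hk => ?_, zero_add]
  rw [iteratedFDeriv_diag_eq_zero (hf.of_le (by exact_mod_cast d.le_succ)) hO
    (Finset.mem_range.1 hk), smul_zero]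

theorem eq_iteratedFDeriv_diag_of_homogeneous (hf : ContDiffAt ℝ (d + 1) f 0)
    (hhom : ∀ (t : ℝ) (x : E), f (t • x) = t ^ d • f x) (x : E) :
    f x = (d.factorial : ℝ)⁻¹ • iteratedFDeriv ℝ d f 0 fun _ => x := by
  refine sub_eq_zero.1 ((vanishesToOrder_sub_leading_term hf
    (.of_homogeneous hf.continuousAt hhom)).eq_zero_of_homogeneous (fun t x => ?_) x)
  rw [hhom, (iteratedFDeriv ℝ d f 0).map_smul_univ (fun _ => t), smul_sub, Finset.prod_const,
    Finset.card_univ, Fintype.card_fin, smul_comm]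

end Taylor

/-! ### Hypersurfaces as graphs -/

section ImplicitGraph

variable {𝕜 E F G : Type*} [RCLike 𝕜] [NormedAddCommGroup E] [NormedSpace 𝕜 E]
  [NormedAddCommGroup F] [NormedSpace 𝕜 F] [NormedAddCommGroup G]
  [NormedSpace 𝕜 G] {H : E × F → G} {u : E × F}

theorem isBigO_sub_of_apply_graph_eq_zero {H' : E × F →L[𝕜] G} (hH : HasStrictFDerivAt H H' u)
    (hinv : (H' ∘L .inr 𝕜 E F).IsInvertible) {φ N : E → F}
    (hφ : Tendsto φ (𝓝 u.1) (𝓝 u.2)) (hN : Tendsto N (𝓝 u.1) (𝓝 u.2))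
    (hzero : ∀ᶠ y in 𝓝 u.1, H (y, φ y) = 0) :
    (fun y => φ y - N y) =O[𝓝 u.1] fun y => H (y, N y) := by
  obtain ⟨A, hA⟩ := hinv
  have hpair : Tendsto (fun y => ((y, φ y), (y, N y))) (𝓝 u.1) (𝓝 (u, u)) :=
    (tendsto_id.prodMk_nhds hφ).prodMk_nhds (tendsto_id.prodMk_nhds hN)
  have hlinear (y : E) : H' ((y, φ y) - (y, N y)) = A (φ y - N y) := by
    rw [show (y, φ y) - (y, N y) = (0, φ y - N y) by simp]
    exact (DFunLike.congr_fun hA (φ y - N y)).symm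
  have hsmall : (fun y => H (y, φ y) - H (y, N y) - A (φ y - N y)) =o[𝓝 u.1]
      fun y => A (φ y - N y) := by
    have h := hH.isLittleO.comp_tendsto hpair
    simp only [Function.comp_def, hlinear] at h
    refine (h.trans_isBigO (IsBigO.of_bound 1 (Eventually.of_forall fun y => ?_))).trans_isBigO
      (A.isBigO_comp_rev (fun y => φ y - N y) _)
    simp [Prod.norm_def]
  have hlarge := hsmall.right_isBigO_add
  refine (A.isBigO_comp_rev (fun y => φ y - N y) _).trans (hlarge.trans_eventuallyEq ?_ |>.trans
    (isBigO_refl _ _).neg_left)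
  filter_upwards [hzero] with y hy
  simp [hy]

variable [CompleteSpace E] [CompleteSpace F] [CompleteSpace G]

theorem exists_contDiffAt_implicitFunction {k : ℕ∞ω} (hk : k ≠ 0)
    (hH : ∀ᶠ x in 𝓝 u, ContDiffAt 𝕜 k H x)
    (hinv : (fderiv 𝕜 H u ∘L .inr 𝕜 E F).IsInvertible) :
    ∃ φ : E → F, φ u.1 = u.2 ∧ (∀ᶠ x in 𝓝 u.1, ContDiffAt 𝕜 k φ x) ∧
      ∀ᶠ x in 𝓝 u, H x = H u ↔ φ x.1 = x.2 := by
  have hHu := hH.self_of_nhds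
  have hinv_near : ∀ᶠ x in 𝓝 u, (fderiv 𝕜 H x ∘L .inr 𝕜 E F).IsInvertible := by
    have hcont : ContinuousAt (fun x => fderiv 𝕜 H x ∘L .inr 𝕜 E F) u :=
      (hHu.continuousAt_fderiv hk).clm_comp continuousAt_const
    obtain ⟨A, hA⟩ := hinv
    exact hcont (by simpa only [← hA] using ContinuousLinearEquiv.nhds A)
  set φ := hHu.implicitFunction hk hinv
  have hφu : φ u.1 = u.2 := hHu.implicitFunction_apply_self hk hinv
  have hiff : ∀ᶠ x in 𝓝 u, H x = H u ↔ φ x.1 = x.2 :=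
    hHu.eventually_apply_eq_iff_implicitFunction hk hinv
  refine ⟨φ, hφu, ?_, hiff⟩
  have hgraph {x : E} (hx : ContinuousAt φ x) : Tendsto (fun y => (y, φ y)) (𝓝 x) (𝓝 (x, φ x)) :=
    continuousAt_id.prodMk hx
  have hcont : ∀ᶠ x in 𝓝 u.1, ContinuousAt φ x :=
    (((hHu.contDiffAt_implicitFunction hk hinv).of_le (ENat.one_le_iff_ne_zero_withTop.2 hk)
      ).eventually (by simp)).mono fun x hx => hx.continuousAt
  have hgraph_u : Tendsto (fun x => (x, φ x)) (𝓝 u.1) (𝓝 u) := by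
    simpa only [hφu] using hgraph hcont.self_of_nhds
  filter_upwards [hgraph_u.eventually (hH.and (hinv_near.and (eventually_eventually_nhds.2 hiff))),
    hcont] with x ⟨hsmooth, hinv_x, hiff_x⟩ hcont_x
  -- Near `x` the function `φ` is the implicit function based at `(x, φ x)`.
  refine (hsmooth.contDiffAt_implicitFunction hk hinv_x).congr_of_eventuallyEq ?_
  have hHx : H (x, φ x) = H u := hiff_x.self_of_nhds.2 rfl
  filter_upwards [(hgraph hcont_x).eventually
    ((hsmooth.eventually_apply_eq_iff_implicitFunction hk hinv_x).and hiff_x)] with y ⟨hy₁, hy₂⟩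
  exact (hy₁.1 ((hy₂.2 rfl).trans hHx.symm)).symm

end ImplicitGraph

section GraphCoordinates

variable {n : ℕ}

/-- The space `ℂⁿ × ℝ` with coordinates `(z, u)`, over which real hypersurfaces of `ℂⁿ × ℂ` are
written as graphs `v = φ(z, u)`. -/
abbrev CnR (n : ℕ) : Type := (Fin n → ℂ) × ℝ

/-- The coordinates `(z, u + iv) ↦ ((z, u), v)`. -/
def graphCoords (n : ℕ) : Cn1 n ≃L[ℝ] CnR n × ℝ :=
  ((ContinuousLinearEquiv.refl ℝ (Fin n → ℂ)).prodCongr Complex.equivRealProdCLM).trans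
    (ContinuousLinearEquiv.prodAssoc ℝ (Fin n → ℂ) ℝ ℝ).symm

/-- The point `(z, u + iv)` over `y = (z, u)`. -/
def pointOver (y : CnR n) (v : ℝ) : Cn1 n := (y.1, ⟨y.2, v⟩)

theorem graphCoords_apply (x : Cn1 n) : graphCoords n x = ((x.1, x.2.re), x.2.im) := rfl

theorem graphCoords_symm_apply (x : CnR n × ℝ) : (graphCoords n).symm x = pointOver x.1 x.2 := by
  rw [ContinuousLinearEquiv.symm_apply_eq]
  rfl

theorem norm_pointOver_le (y : CnR n) (v : ℝ) : ‖pointOver y v‖ ≤ ‖y‖ + |v| := by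
  refine max_le ((norm_fst_le y).trans (le_add_of_nonneg_right (abs_nonneg v))) ?_
  exact (Complex.norm_le_abs_re_add_abs_im _).trans (add_le_add (norm_snd_le y) le_rfl)

theorem VanishesToOrder.pointOver {N : CnR n → ℝ} (hN : VanishesToOrder 1 N) :
    VanishesToOrder 1 fun y => pointOver y (N y) := by
  have hid : VanishesToOrder 1 fun y : CnR n => y := by
    simpa [VanishesToOrder] using (isBigO_refl (fun y : CnR n => y) (𝓝 0)).norm_right
  refine IsBigO.trans (IsBigO.of_bound 1 (Eventually.of_forall fun y => ?_))
    (hid.norm_left.add hN.norm_left)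
  rw [one_mul, Real.norm_of_nonneg (by positivity)]
  exact norm_pointOver_le y (N y)

theorem vanishesToOrder_pointOver_zero : VanishesToOrder 1 fun y : CnR n => pointOver y 0 :=
  VanishesToOrder.pointOver (isBigO_zero _ _)

theorem vanishesToOrder_pointOver_sub {N : CnR n → ℝ} {k : ℕ} (hN : VanishesToOrder k N) :
    VanishesToOrder k fun y => pointOver y (N y) - pointOver y 0 := by
  refine IsBigO.trans (IsBigO.of_bound 1 (Eventually.of_forall fun y => ?_)) hN
  have hsub : pointOver y (N y) - pointOver y 0 = (0, ⟨0, N y⟩) := by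
    ext : 1
    · exact sub_self y.1
    · exact Complex.ext (sub_self y.2) (sub_zero (N y))
  rw [hsub, one_mul, Prod.norm_mk, norm_zero, max_le_iff]
  exact ⟨norm_nonneg _, by simpa using Complex.norm_le_abs_re_add_abs_im ⟨0, N y⟩⟩

theorem exists_graph {H : Cn1 n → ℝ} (hH : ∀ᶠ x in 𝓝 0, ContDiffAt ℝ ∞ H x) (h0 : H 0 = 0)
    (hd : ∀ x, fderiv ℝ H 0 x = x.2.im) {N : CnR n → ℝ} {k : ℕ} (hN : Tendsto N (𝓝 0) (𝓝 0))
    (hk : VanishesToOrder k fun y => H (pointOver y (N y))) :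
    ∃ φ : CnR n → ℝ, (∀ᶠ y in 𝓝 0, ContDiffAt ℝ ∞ φ y) ∧ φ 0 = 0 ∧
      VanishesToOrder k (fun y => φ y - N y) ∧
      ∀ᶠ x in 𝓝 0, H x = 0 ↔ x.2.im = φ (x.1, x.2.re) := by
  let e := (graphCoords n).symm
  have he : Tendsto e (𝓝 0) (𝓝 0) := by simpa using e.continuous.tendsto 0
  have hsmooth : ∀ᶠ y in 𝓝 0, ContDiffAt ℝ ∞ (H ∘ e) y :=
    (he.eventually hH).mono fun y hy => hy.comp y e.contDiff.contDiffAt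
  have hstrict := hsmooth.self_of_nhds.hasStrictFDerivAt (by simp)
  have hfderiv : fderiv ℝ (H ∘ e) 0 ∘L .inr ℝ (CnR n) ℝ = ContinuousLinearEquiv.refl ℝ ℝ := by
    rw [e.comp_right_fderiv, map_zero]
    ext
    simp [hd, e, graphCoords_symm_apply, pointOver]
  have hinv : (fderiv ℝ (H ∘ e) 0 ∘L .inr ℝ (CnR n) ℝ).IsInvertible := ⟨_, hfderiv.symm⟩
  obtain ⟨φ, hφ0, hφ, hiff⟩ := exists_contDiffAt_implicitFunction (by simp) hsmooth hinv
  have hiff' : ∀ᶠ x in 𝓝 0, H (e x) = 0 ↔ φ x.1 = x.2 := by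
    simpa only [Function.comp_apply, map_zero, h0] using hiff
  rw [Prod.fst_zero] at hφ hφ0
  rw [Prod.snd_zero] at hφ0
  have hφt : Tendsto φ (𝓝 0) (𝓝 0) := by
    simpa only [hφ0] using hφ.self_of_nhds.continuousAt.tendsto
  have hpair : Tendsto (fun y => (y, φ y)) (𝓝 0) (𝓝 0) := tendsto_id.prodMk_nhds hφt
  refine ⟨φ, hφ, hφ0, IsBigO.trans ?_ hk, ?_⟩
  · simpa only [Function.comp_apply, e, graphCoords_symm_apply] using
      isBigO_sub_of_apply_graph_eq_zero (u := (0, 0)) hstrict hinv hφt hN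
        ((hpair.eventually hiff').mono fun y hy => hy.2 rfl)
  · have hcoords : Tendsto (graphCoords n) (𝓝 0) (𝓝 0) := by
      simpa only [map_zero] using (graphCoords n).continuous.tendsto 0
    filter_upwards [hcoords.eventually hiff'] with x hx
    rw [(graphCoords n).symm_apply_apply, graphCoords_apply] at hx
    rw [hx, eq_comm]

end GraphCoordinates

section LevelSet

variable {E : Type*} [NormedAddCommGroup E] [NormedSpace ℝ E] [CompleteSpace E]

theorem apply_eq_zero_of_eventually_eq_zero_on_levelSet {f g : E → ℝ} {f' g' : E →L[ℝ] ℝ} {q : E}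
    (hf : HasStrictFDerivAt f f' q) (hf' : f' ≠ 0) (hg : HasStrictFDerivAt g g' q)
    (hfg : ∀ᶠ x in 𝓝 q, f x = f q → g x = 0) {v : E} (hv : f' v = 0) : g' v = 0 := by
  have hextr : IsLocalExtrOn g {x | f x = f q} q := by
    refine Or.inl ?_
    filter_upwards [nhdsWithin_le_nhds hfg, self_mem_nhdsWithin] with x hx hmem
    rw [hx hmem, hfg.self_of_nhds rfl]
  obtain ⟨a, b, hab, hmult⟩ := hextr.exists_multipliers_of_hasStrictFDerivAt_1d hf hg
  have hb : b ≠ 0 := by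
    rintro rfl
    rw [zero_smul, add_zero, smul_eq_zero] at hmult
    exact hab (Prod.ext (hmult.resolve_right hf') rfl)
  simpa [hv, hb] using DFunLike.congr_fun hmult v

end LevelSet

/-! ### The Levi form in terms of a defining function -/

section Hessian

variable {E : Type*} [NormedAddCommGroup E] [NormedSpace ℝ E] {ρ : E → ℝ} {p : E}

/-- The second differential of `ρ` at `p`, as a bilinear form. -/
def hess (ρ : E → ℝ) (p : E) : E →L[ℝ] E →L[ℝ] ℝ := fderiv ℝ (fderiv ℝ ρ) p

theorem hess_comm (hρ : ContDiffAt ℝ 2 ρ p) (a b : E) : hess ρ p a b = hess ρ p b a :=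
  hρ.isSymmSndFDerivAt (by simp) a b

theorem hasStrictFDerivAt_fderiv_apply (hρ : ContDiffAt ℝ 2 ρ p) (b : E) :
    HasStrictFDerivAt (fun q => fderiv ℝ ρ q b) ((hess ρ p).flip b) p :=
  (ContinuousLinearMap.apply ℝ ℝ b).hasStrictFDerivAt.comp p
    ((hρ.fderiv_right (m := 1) (by norm_num)).hasStrictFDerivAt (by simp))

end Hessian

theorem I_smul_I_smul {V : Type*} [AddCommGroup V] [Module ℂ V] (v : V) :
    Complex.I • Complex.I • v = -v := by
  rw [smul_smul, Complex.I_mul_I, neg_one_smul]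

section OneForm

variable {R V W : Type*} [Ring R] [AddCommGroup V] [Module R V] [TopologicalSpace V]
  [AddCommGroup W] [Module R W] [TopologicalSpace W]

theorem oneForm_add (η : V [⋀^Fin 1]→L[R] W) (x y : V) : η ![x + y] = η ![x] + η ![y] :=
  η.map_vecCons_add (n := 0) ![] x y

theorem oneForm_sub (η : V [⋀^Fin 1]→L[R] W) (x y : V) : η ![x - y] = η ![x] - η ![y] := by
  rw [eq_sub_iff_add_eq, ← oneForm_add, sub_add_cancel]

theorem oneForm_smul (η : V [⋀^Fin 1]→L[R] W) (c : R) (x : V) : η ![c • x] = c • η ![x] :=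
  η.map_vecCons_smul (n := 0) ![] c x

end OneForm

section Tangent

variable {n : ℕ} {M : Set (Cn1 n)} {p q : Cn1 n} {ρ : Cn1 n → ℝ}

namespace IsLocalDefining

theorem eventually_contDiffAt (hρ : IsLocalDefining M q ρ) : ∀ᶠ x in 𝓝 q, ContDiffAt ℝ ∞ ρ x := by
  obtain ⟨U, hU, hq, hc, -, -⟩ := hρ
  filter_upwards [hU.mem_nhds hq] with x hx
  exact hc.contDiffAt (hU.mem_nhds hx)

theorem contDiffAt (hρ : IsLocalDefining M q ρ) : ContDiffAt ℝ ∞ ρ q :=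
  hρ.eventually_contDiffAt.self_of_nhds

theorem contDiffAt_two (hρ : IsLocalDefining M q ρ) : ContDiffAt ℝ 2 ρ q :=
  hρ.contDiffAt.of_le (WithTop.coe_le_coe.2 (le_top : (2 : ℕ∞) ≤ ⊤))

theorem hasStrictFDerivAt (hρ : IsLocalDefining M q ρ) :
    HasStrictFDerivAt ρ (fderiv ℝ ρ q) q :=
  hρ.contDiffAt.hasStrictFDerivAt (by simp)

theorem fderiv_ne_zero (hρ : IsLocalDefining M q ρ) : fderiv ℝ ρ q ≠ 0 :=
  hρ.choose_spec.2.2.2.1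

theorem eventually_mem_iff (hρ : IsLocalDefining M q ρ) : ∀ᶠ x in 𝓝 q, x ∈ M ↔ ρ x = 0 := by
  obtain ⟨U, hU, hq, -, -, h⟩ := hρ
  filter_upwards [hU.mem_nhds hq] with x hx using h x hx

theorem apply_eq_zero (hρ : IsLocalDefining M q ρ) (hq : q ∈ M) : ρ q = 0 :=
  hρ.eventually_mem_iff.self_of_nhds.1 hq

theorem of_eventually (hc : ∀ᶠ x in 𝓝 q, ContDiffAt ℝ ∞ ρ x) (hd : fderiv ℝ ρ q ≠ 0)
    (hM : ∀ᶠ x in 𝓝 q, x ∈ M ↔ ρ x = 0) : IsLocalDefining M q ρ := by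
  obtain ⟨U, hU_imp, hU, hq⟩ := eventually_nhds_iff.1 (hc.and hM)
  exact ⟨U, hU, hq, fun x hx => (hU_imp x hx).1.contDiffWithinAt, hd,
    fun x hx => (hU_imp x hx).2⟩

theorem const_smul (hρ : IsLocalDefining M q ρ) {c : ℝ} (hc : c ≠ 0) :
    IsLocalDefining M q (c • ρ) := by
  refine of_eventually (hρ.eventually_contDiffAt.mono fun x hx => hx.const_smul c) ?_ ?_
  · rw [fderiv_const_smul_field]
    exact smul_ne_zero hc hρ.fderiv_ne_zero
  · exact hρ.eventually_mem_iff.mono fun x hx => by simp [hx, hc]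

theorem eventually (hρ : IsLocalDefining M p ρ) : ∀ᶠ q in 𝓝 p, IsLocalDefining M q ρ := by
  have hne : ∀ᶠ q in 𝓝 p, fderiv ℝ ρ q ≠ 0 :=
    (hρ.contDiffAt.continuousAt_fderiv (by simp)).eventually_ne hρ.fderiv_ne_zero
  filter_upwards [eventually_eventually_nhds.2 hρ.eventually_contDiffAt, hne,
    eventually_eventually_nhds.2 hρ.eventually_mem_iff] with q hc hd hM
  exact of_eventually hc hd hM

theorem apply_eq_zero_of_fderiv_eq_zero (hρ : IsLocalDefining M q ρ) (hq : q ∈ M)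
    {h : Cn1 n → ℝ} {h' : Cn1 n →L[ℝ] ℝ} (hh : HasStrictFDerivAt h h' q)
    (hM : ∀ᶠ x in 𝓝 q, x ∈ M → h x = 0) {v : Cn1 n} (hv : fderiv ℝ ρ q v = 0) : h' v = 0 := by
  refine apply_eq_zero_of_eventually_eq_zero_on_levelSet hρ.hasStrictFDerivAt hρ.fderiv_ne_zero
    hh ?_ hv
  filter_upwards [hρ.eventually_mem_iff, hM] with x hx₁ hx₂ hρx
  exact hx₂ (hx₁.2 (hρx.trans (hρ.apply_eq_zero hq)))

theorem mem_tangentSpaceAt (hρ : IsLocalDefining M q ρ) (hq : q ∈ M) {v : Cn1 n} :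
    v ∈ tangentSpaceAt M q ↔ fderiv ℝ ρ q v = 0 := by
  simp only [tangentSpaceAt, Submodule.mem_iInf]
  exact ⟨fun h => h ρ hρ, fun hv ρ' hρ' => hρ.apply_eq_zero_of_fderiv_eq_zero hq
    hρ'.hasStrictFDerivAt (hρ'.eventually_mem_iff.mono fun x hx => hx.1) hv⟩

theorem mem_complexTangentSpaceAt (hρ : IsLocalDefining M q ρ) (hq : q ∈ M) {v : Cn1 n} :
    v ∈ complexTangentSpaceAt M q ↔ fderiv ℝ ρ q v = 0 ∧ fderiv ℝ ρ q (Complex.I • v) = 0 := by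
  rw [← hρ.mem_tangentSpaceAt hq, ← hρ.mem_tangentSpaceAt hq]
  rfl

/-- The vector is `|∂ρ(e)|² b - ∂ρ(b) conj(∂ρ(e)) e`, up to a constant factor. -/
theorem projection_mem_complexTangentSpaceAt (hρ : IsLocalDefining M q ρ) (hq : q ∈ M)
    (b e : Cn1 n) {α β γ δ : ℝ} (hα : fderiv ℝ ρ q b = α) (hβ : fderiv ℝ ρ q (Complex.I • b) = β)
    (hγ : fderiv ℝ ρ q e = γ) (hδ : fderiv ℝ ρ q (Complex.I • e) = δ) :
    (γ * γ + δ * δ) • b - (α * γ + β * δ) • e - (α * δ - β * γ) • Complex.I • e ∈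
      complexTangentSpaceAt M q := by
  rw [hρ.mem_complexTangentSpaceAt hq]
  simp only [smul_sub, smul_comm Complex.I (_ : ℝ), I_smul_I_smul, map_sub, map_smul, map_neg,
    smul_eq_mul, hα, hβ, hγ, hδ]
  constructor <;> ring

end IsLocalDefining

section ContactForm

variable {θ : tangentSpaceAt M p →ₗ[ℝ] ℝ} {Θ : Cn1 n → Cn1 n [⋀^Fin 1]→L[ℝ] ℝ}

namespace IsContactExtension

theorem contDiffAt (hΘ : IsContactExtension M p θ Θ) : ContDiffAt ℝ ∞ Θ p := by
  obtain ⟨⟨U, hU, hpU, hc, -⟩, -⟩ := hΘ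
  exact hc.contDiffAt (hU.mem_nhds hpU)

theorem eventually_annihilates (hΘ : IsContactExtension M p θ Θ) :
    ∀ᶠ q in 𝓝 p, q ∈ M → ∀ x ∈ complexTangentSpaceAt M q, Θ q ![x] = 0 := by
  obtain ⟨⟨U, hU, hpU, -, hann⟩, -⟩ := hΘ
  filter_upwards [hU.mem_nhds hpU] with q hqU hqM using hann q ⟨hqM, hqU⟩

theorem hasStrictFDerivAt_apply (hΘ : IsContactExtension M p θ Θ) (v : Fin 1 → Cn1 n) :
    HasStrictFDerivAt (fun q => Θ q v) (fderiv ℝ (fun q => Θ q v) p) p :=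
  ContDiffAt.hasStrictFDerivAt (n := 1)
    ((ContinuousAlternatingMap.apply ℝ (Cn1 n) ℝ v).contDiff.contDiffAt.comp p
      (hΘ.contDiffAt.of_le (by simp))) (by simp)

/-- Every `b` is corrected by a combination of `e` and `I • e` to a complex tangent vector at `q`,
on which `Θ q` vanishes; differentiate this relation along `M`. -/
theorem fderiv_apply (hΘ : IsContactExtension M p θ Θ) (hρ : IsLocalDefining M p ρ) (hp : p ∈ M)
    {e a b : Cn1 n} (he : fderiv ℝ ρ p e = 1) (heI : fderiv ℝ ρ p (Complex.I • e) = 0)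
    (ha : a ∈ complexTangentSpaceAt M p) (hb : b ∈ complexTangentSpaceAt M p) :
    fderiv ℝ (fun q => Θ q ![b]) p a =
      hess ρ p a b * Θ p ![e] - hess ρ p a (Complex.I • b) * Θ p ![Complex.I • e] := by
  have hderiv (v : Cn1 n) : HasStrictFDerivAt (fun q => fderiv ℝ ρ q v) ((hess ρ p).flip v) p :=
    hasStrictFDerivAt_fderiv_apply hρ.contDiffAt_two v
  have hα := hderiv b
  have hβ := hderiv (Complex.I • b)
  have hγ := hderiv e
  have hδ := hderiv (Complex.I • e)
  have hΘb := hΘ.hasStrictFDerivAt_apply ![b]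
  have hΘe := hΘ.hasStrictFDerivAt_apply ![e]
  have hΘIe := hΘ.hasStrictFDerivAt_apply ![Complex.I • e]
  have hrelation := ((((hγ.mul hγ).add (hδ.mul hδ)).mul hΘb).sub
    (((hα.mul hγ).add (hβ.mul hδ)).mul hΘe)).sub (((hα.mul hδ).sub (hβ.mul hγ)).mul hΘIe)
  have hvanish := hρ.apply_eq_zero_of_fderiv_eq_zero hp hrelation ?_
    ((hρ.mem_complexTangentSpaceAt hp).1 ha).1
  · obtain ⟨hb₁, hb₂⟩ := (hρ.mem_complexTangentSpaceAt hp).1 hb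
    simp [hb₁, hb₂, he, heI, hΘ.eventually_annihilates.self_of_nhds hp b hb] at hvanish
    linarith
  · filter_upwards [hρ.eventually, hΘ.eventually_annihilates] with q hq hann hqM
    have hzero := hann hqM _ (hq.projection_mem_complexTangentSpaceAt hqM b e rfl rfl rfl rfl)
    simp only [oneForm_sub, oneForm_smul, smul_eq_mul] at hzero
    exact hzero

end IsContactExtension

theorem extDeriv_pair {E F : Type*} [NormedAddCommGroup E] [NormedSpace ℝ E]
    [NormedAddCommGroup F] [NormedSpace ℝ F] {η : E → E [⋀^Fin 1]→L[ℝ] F} {p : E}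
    (hη : DifferentiableAt ℝ η p) (a b : E) : extDeriv η p ![a, b] =
      fderiv ℝ (fun q => η q ![b]) p a - fderiv ℝ (fun q => η q ![a]) p b := by
  have h0 : (0 : Fin 2).removeNth ![a, b] = ![b] := by ext i : 1; fin_cases i; rfl
  have h1 : (1 : Fin 2).removeNth ![a, b] = ![a] := by ext i : 1; fin_cases i; rfl
  rw [extDeriv_apply hη, Fin.sum_univ_two, h0, h1]
  simp [sub_eq_add_neg]

theorem IsContactExtension.leviForm_self (hΘ : IsContactExtension M p θ Θ)
    (hρ : IsLocalDefining M p ρ) (hp : p ∈ M) {e a : Cn1 n} (he : fderiv ℝ ρ p e = 1)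
    (heI : fderiv ℝ ρ p (Complex.I • e) = 0) (ha : a ∈ complexTangentSpaceAt M p) :
    leviForm Θ p a a = ((Θ p ![Complex.I • e] / 2 *
      (hess ρ p a a + hess ρ p (Complex.I • a) (Complex.I • a)) : ℝ) : ℂ) := by
  have hIa : Complex.I • a ∈ complexTangentSpaceAt M p := Submodule.smul_mem _ _ ha
  have hfderiv {x y : Cn1 n} (hx : x ∈ complexTangentSpaceAt M p)
      (hy : y ∈ complexTangentSpaceAt M p) := hΘ.fderiv_apply hρ hp he heI hx hy
  have hcomm := hess_comm hρ.contDiffAt_two (Complex.I • a) a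
  simp only [leviForm, extDeriv_pair (hΘ.contDiffAt.differentiableAt (by simp)), hfderiv ha ha,
    hfderiv ha hIa, hfderiv hIa ha, hfderiv hIa hIa, I_smul_I_smul, map_neg, hcomm]
  push_cast
  linear_combination (- (1 / 2) * (hess ρ p a a : ℂ) * (Θ p ![Complex.I • e]) - (1 / 2) *
    (hess ρ p (Complex.I • a) (Complex.I • a) : ℂ) * (Θ p ![Complex.I • e])) * Complex.I_mul_I

theorem leviForm_add_left (Θ : Cn1 n → Cn1 n [⋀^Fin 1]→L[ℝ] ℝ) (p a a' b : Cn1 n) :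
    leviForm Θ p (a + a') b = leviForm Θ p a b + leviForm Θ p a' b := by
  have hadd (x y z : Cn1 n) :
      extDeriv Θ p ![x + y, z] = extDeriv Θ p ![x, z] + extDeriv Θ p ![y, z] :=
    (extDeriv Θ p).map_vecCons_add ![z] x y
  simp only [leviForm, smul_add, hadd]
  push_cast
  ring

theorem leviForm_smul_left (Θ : Cn1 n → Cn1 n [⋀^Fin 1]→L[ℝ] ℝ) (p : Cn1 n) (c : ℂ)
    (a b : Cn1 n) : leviForm Θ p (c • a) b = c * leviForm Θ p a b := by
  have hsmul (r : ℝ) (y z : Cn1 n) : extDeriv Θ p ![r • y, z] = r * extDeriv Θ p ![y, z] :=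
    (extDeriv Θ p).map_vecCons_smul ![z] r y
  have hreal (r : ℝ) (a : Cn1 n) : leviForm Θ p (r • a) b = r * leviForm Θ p a b := by
    simp only [leviForm, smul_comm Complex.I r, hsmul]
    push_cast
    ring
  have hI : leviForm Θ p (Complex.I • a) b = Complex.I * leviForm Θ p a b := by
    have hneg (y z : Cn1 n) : extDeriv Θ p ![-y, z] = -extDeriv Θ p ![y, z] := by
      simpa using hsmul (-1) y z
    simp only [leviForm, I_smul_I_smul, hneg]
    push_cast
    linear_combination (1 / 4 * (extDeriv Θ p ![a, Complex.I • b] : ℂ)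
      - 1 / 4 * extDeriv Θ p ![Complex.I • a, b]) * Complex.I * Complex.I_sq
  calc leviForm Θ p (c • a) b = leviForm Θ p (c.re • a + c.im • Complex.I • a) b := by
        rw [← Complex.coe_smul c.re, ← Complex.coe_smul c.im, smul_smul, ← add_smul,
          Complex.re_add_im]
    _ = (c.re + c.im * Complex.I) * leviForm Θ p a b := by
        rw [leviForm_add_left, hreal, hreal, hI]
        ring
    _ = c * leviForm Θ p a b := by rw [Complex.re_add_im]

/-- The Levi form as a sesquilinear map, antilinear in its second argument. -/
def leviSesq (Θ : Cn1 n → Cn1 n [⋀^Fin 1]→L[ℝ] ℝ) (p : Cn1 n) :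
    Cn1 n →ₗ[ℂ] Cn1 n →ₗ⋆[ℂ] ℂ :=
  LinearMap.mk₂'ₛₗ (RingHom.id ℂ) (starRingEnd ℂ) (leviForm Θ p)
    (leviForm_add_left Θ p) (leviForm_smul_left Θ p)
    (fun a b b' => by
      rw [← leviForm_conj, leviForm_add_left, map_add, leviForm_conj, leviForm_conj])
    (fun c a b => by
      rw [← leviForm_conj, leviForm_smul_left, map_mul, leviForm_conj]
      rfl)

theorem leviForm_sum_sum {ι : Type*} [Fintype ι] (Θ : Cn1 n → Cn1 n [⋀^Fin 1]→L[ℝ] ℝ)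
    (p : Cn1 n) (x y : ι → ℂ) (b : ι → Cn1 n) :
    leviForm Θ p (∑ i, x i • b i) (∑ j, y j • b j) =
      ∑ i, ∑ j, x i * leviForm Θ p (b i) (b j) * conj (y j) := by
  change leviSesq Θ p (∑ i, x i • b i) (∑ j, y j • b j) =
    ∑ i, ∑ j, x i * leviSesq Θ p (b i) (b j) * conj (y j)
  simp only [map_sum, LinearMap.sum_apply, map_smul, LinearMap.smul_apply, map_smulₛₗ,
    smul_eq_mul, Finset.mul_sum]
  refine Finset.sum_comm.trans ?_
  refine Finset.sum_congr rfl fun i _ => Finset.sum_congr rfl fun j _ => ?_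
  ring

end ContactForm

end Tangent

/-! ### Adapted frames -/

section Sylvester

variable {n ℓ : ℕ}

theorem conj_sgn (ℓ : ℕ) (j : Fin n) : conj (sgn ℓ j) = sgn ℓ j := by
  unfold sgn
  split_ifs <;> simp

theorem sgn_mul_self (ℓ : ℕ) (j : Fin n) : sgn ℓ j * sgn ℓ j = 1 := by
  unfold sgn
  split_ifs <;> simp

theorem normSqL_eq_re (ℓ : ℕ) (z : Fin n → ℂ) : ((normSqL ℓ z).re : ℂ) = normSqL ℓ z := by
  rw [← Complex.conj_eq_iff_re, normSqL, map_sum]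
  refine Finset.sum_congr rfl fun j _ => ?_
  rw [map_mul, map_mul, conj_sgn, Complex.conj_conj, mul_comm (conj (z j))]

theorem exists_perm_forall_iff_lt_card (P : Fin n → Prop) [DecidablePred P] :
    ∃ e : Equiv.Perm (Fin n), ∀ k, P (e k) ↔ (k : ℕ) < (Finset.univ.filter P).card := by
  have hle : (Finset.univ.filter P).card ≤ n := by
    simpa using Finset.card_filter_le Finset.univ P
  have hcard : Fintype.card {k : Fin n // (k : ℕ) < (Finset.univ.filter P).card} =
      Fintype.card {i // P i} := by
    rw [Fintype.card_subtype, Fintype.card_subtype, Fin.card_filter_val_lt, min_eq_right hle]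
  let e := Fintype.equivOfCardEq hcard
  exact ⟨e.extendSubtype, fun k =>
    ⟨fun h => not_imp_not.1 (e.extendSubtype_not_mem k) h, e.extendSubtype_mem k⟩⟩

theorem forall_ne_zero_of_card_neg_add_card_pos {ι : Type*} [Fintype ι] {f : ι → ℝ}
    (h : (Finset.univ.filter fun i => f i < 0).card + (Finset.univ.filter fun i => 0 < f i).card =
      Fintype.card ι) (i : ι) : f i ≠ 0 := by
  classical
  have hdisj : Disjoint (Finset.univ.filter fun i => f i < 0)
      (Finset.univ.filter fun i => 0 < f i) :=
    Finset.disjoint_filter.2 fun i _ h₁ h₂ => lt_asymm h₁ h₂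
  rw [← Finset.card_union_of_disjoint hdisj, Finset.card_eq_iff_eq_univ, ← Finset.filter_or] at h
  exact (Finset.filter_eq_self.1 h i (Finset.mem_univ i)).elim ne_of_lt ne_of_gt

theorem exists_perm_mul_mul_eq_sgn {f : Fin n → ℝ}
    (hneg : (Finset.univ.filter fun i => f i < 0).card = ℓ)
    (hpos : (Finset.univ.filter fun i => 0 < f i).card = n - ℓ) :
    ∃ (e : Equiv.Perm (Fin n)) (r : Fin n → ℝ), ∀ k, (r k : ℂ) * f (e k) * r k = sgn ℓ k := by
  obtain ⟨e, he⟩ := exists_perm_forall_iff_lt_card fun i => f i < 0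
  rw [hneg] at he
  have hℓ : ℓ ≤ n := by
    rw [← hneg]
    exact (Finset.card_filter_le _ _).trans_eq (Finset.card_fin n)
  have hne : ∀ i, f i ≠ 0 := by
    refine forall_ne_zero_of_card_neg_add_card_pos ?_
    rw [hneg, hpos, Fintype.card_fin, Nat.add_sub_cancel' hℓ]
  refine ⟨e, fun k => (√|f (e k)|)⁻¹, fun k => ?_⟩
  have hsq : (((√|f (e k)|)⁻¹ : ℝ) : ℂ) * ((√|f (e k)|)⁻¹ : ℝ) = ((|f (e k)| : ℝ) : ℂ)⁻¹ := by
    rw [← Complex.ofReal_mul, ← mul_inv, Real.mul_self_sqrt (abs_nonneg _), Complex.ofReal_inv]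
  have h0 : (f (e k) : ℂ) ≠ 0 := by exact_mod_cast hne _
  rw [mul_right_comm, hsq, sgn]
  split_ifs with hk
  · rw [abs_of_neg ((he k).2 hk), Complex.ofReal_neg, inv_neg, neg_mul, inv_mul_cancel₀ h0]
  · rw [abs_of_nonneg (not_lt.1 fun h => hk ((he k).1 h)), inv_mul_cancel₀ h0]

theorem exists_mul_mul_conjTranspose_eq_diagonal_sgn {A : Matrix (Fin n) (Fin n) ℂ}
    (hA : A.IsHermitian) (hneg : (Finset.univ.filter fun i => hA.eigenvalues i < 0).card = ℓ)
    (hpos : (Finset.univ.filter fun i => 0 < hA.eigenvalues i).card = n - ℓ) :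
    ∃ C : Matrix (Fin n) (Fin n) ℂ, C * A * C.conjTranspose = Matrix.diagonal (sgn ℓ) := by
  obtain ⟨e, r, hr⟩ := exists_perm_mul_mul_eq_sgn hneg hpos
  let D : Matrix (Fin n) (Fin n) ℂ := Matrix.diagonal fun k => (r k : ℂ)
  have hD : D.conjTranspose = D := by
    rw [Matrix.diagonal_conjTranspose]
    congr 1
    ext k
    exact Complex.conj_ofReal _
  let U : Matrix (Fin n) (Fin n) ℂ := hA.eigenvectorUnitary
  have hU : U.conjTranspose * A * U = Matrix.diagonal fun i => (hA.eigenvalues i : ℂ) := by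
    have hconj := hA.conjStarAlgAut_star_eigenvectorUnitary
    rw [Unitary.conjStarAlgAut_star_apply] at hconj
    exact hconj
  have hUe : U.conjTranspose.submatrix e id * A * U.submatrix id e =
      Matrix.diagonal fun k => (hA.eigenvalues (e k) : ℂ) := by
    rw [← Function.comp_def (fun i => (hA.eigenvalues i : ℂ)) e,
      ← Matrix.submatrix_diagonal_equiv, ← hU]
    rfl
  refine ⟨D * U.conjTranspose.submatrix e id, ?_⟩
  calc D * U.conjTranspose.submatrix e id * A *
        (D * U.conjTranspose.submatrix e id).conjTranspose
      = D * (U.conjTranspose.submatrix e id * A * U.submatrix id e) *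
          D := by
        rw [Matrix.conjTranspose_mul, hD, Matrix.conjTranspose_submatrix,
          Matrix.conjTranspose_conjTranspose]
        simp only [Matrix.mul_assoc]
    _ = Matrix.diagonal (sgn ℓ) := by
        simp only [hUe, D, Matrix.diagonal_mul_diagonal, hr]

end Sylvester

section AdaptedFrame

variable {n ℓ : ℕ} {M : Set (Cn1 n)} {p : Cn1 n} {ρ : Cn1 n → ℝ}
  {θ : tangentSpaceAt M p →ₗ[ℝ] ℝ} {Θ : Cn1 n → Cn1 n [⋀^Fin 1]→L[ℝ] ℝ}

theorem exists_apply_eq_one_apply_I_smul_eq_zero {V : Type*} [AddCommGroup V] [Module ℂ V]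
    {D : V →ₗ[ℝ] ℝ} (hD : D ≠ 0) : ∃ e, D e = 1 ∧ D (Complex.I • e) = 0 := by
  obtain ⟨x, hx⟩ := DFunLike.ne_iff.1 hD
  rw [LinearMap.zero_apply] at hx
  have hne : D x ^ 2 + D (Complex.I • x) ^ 2 ≠ 0 := by positivity
  refine ⟨(D x ^ 2 + D (Complex.I • x) ^ 2)⁻¹ • (D x • x + D (Complex.I • x) • Complex.I • x),
    ?_, ?_⟩
  · simp only [map_add, map_smul, smul_eq_mul]
    field_simp
  · simp only [smul_add, smul_comm Complex.I (_ : ℝ), I_smul_I_smul, map_add, map_smul, map_neg,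
      smul_eq_mul]
    ring

theorem IsContactExtension.apply_I_smul_ne_zero (hΘ : IsContactExtension M p θ Θ) (hθ : θ ≠ 0)
    (hρ : IsLocalDefining M p ρ) (hp : p ∈ M) {e : Cn1 n} (he : fderiv ℝ ρ p e = 1)
    (heI : fderiv ℝ ρ p (Complex.I • e) = 0) : Θ p ![Complex.I • e] ≠ 0 := by
  refine fun hzero => hθ (LinearMap.ext fun x => ?_)
  have hx : fderiv ℝ ρ p x = 0 := (hρ.mem_tangentSpaceAt hp).1 x.2
  have hmem : (x : Cn1 n) + fderiv ℝ ρ p (Complex.I • (x : Cn1 n)) • Complex.I • e ∈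
      complexTangentSpaceAt M p := by
    simp [hρ.mem_complexTangentSpaceAt hp, hx, he, heI, smul_comm Complex.I (_ : ℝ), I_smul_I_smul]
  have hann := hΘ.eventually_annihilates.self_of_nhds hp _ hmem
  rw [oneForm_add, oneForm_smul, hzero, smul_zero, add_zero, hΘ.2] at hann
  exact hann

theorem IsContactExtension.exists_isLocalDefining_normalized (hΘ : IsContactExtension M p θ Θ)
    (hθ : θ ≠ 0) (hM : ∃ ρ, IsLocalDefining M p ρ) (hp : p ∈ M) :
    ∃ ρ e, IsLocalDefining M p ρ ∧ fderiv ℝ ρ p e = 1 ∧ fderiv ℝ ρ p (Complex.I • e) = 0 ∧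
      Θ p ![Complex.I • e] = -(1 / 2) := by
  obtain ⟨ρ, hρ⟩ := hM
  obtain ⟨e, he, heI⟩ := exists_apply_eq_one_apply_I_smul_eq_zero (D := (fderiv ℝ ρ p).toLinearMap)
    (mod_cast hρ.fderiv_ne_zero)
  have hκ := hΘ.apply_I_smul_ne_zero hθ hρ hp he heI
  set κ := Θ p ![Complex.I • e]
  have hne : -2 * κ ≠ 0 := mul_ne_zero (by norm_num) hκ
  refine ⟨(-2 * κ) • ρ, (-2 * κ)⁻¹ • e, hρ.const_smul hne, ?_, ?_, ?_⟩
  · rw [fderiv_const_smul_field, Pi.smul_apply, smul_apply, map_smul, smul_inv_smul₀ hne]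
    exact he
  · rw [fderiv_const_smul_field, smul_comm Complex.I (_ : ℝ), Pi.smul_apply, smul_apply, map_smul,
      smul_inv_smul₀ hne]
    exact heI
  · rw [smul_comm Complex.I (_ : ℝ), oneForm_smul, smul_eq_mul]
    change (-2 * κ)⁻¹ * κ = _
    field_simp

theorem IsAppropriateContactForm.exists_leviForm_orthonormal
    (hθ : IsAppropriateContactForm M ℓ p θ) :
    ∃ Θ, IsContactExtension M p θ Θ ∧ ∃ f : Fin n → Cn1 n,
      (∀ k, f k ∈ complexTangentSpaceAt M p) ∧
      ∀ k l, leviForm Θ p (f k) (f l) = if k = l then sgn ℓ k else 0 := by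
  obtain ⟨-, -, Θ, hΘ, b, hneg, hpos⟩ := hθ
  obtain ⟨C, hC⟩ := exists_mul_mul_conjTranspose_eq_diagonal_sgn _ hneg hpos
  refine ⟨Θ, hΘ, fun k => ∑ i, C k i • (b i : Cn1 n), fun k =>
    Submodule.sum_mem _ fun i _ => Submodule.smul_mem _ _ (b i).2, fun k l => ?_⟩
  rw [leviForm_sum_sum, ← Matrix.diagonal_apply, ← hC, Matrix.mul_apply, Finset.sum_comm]
  simp only [Matrix.mul_apply, Finset.sum_mul]
  rfl

/-- The complex linear map `(z, w) ↦ ∑ z_k f_k - i w e`. -/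
def frameMap (f : Fin n → Cn1 n) (e : Cn1 n) : Cn1 n →ₗ[ℂ] Cn1 n :=
  (Fintype.linearCombination ℂ f).coprod (LinearMap.toSpanSingleton ℂ (Cn1 n) (-Complex.I • e))

theorem frameMap_apply (f : Fin n → Cn1 n) (e x : Cn1 n) :
    frameMap f e x = ∑ k, x.1 k • f k + (x.2.im • e - x.2.re • Complex.I • e) := by
  have hw : x.2 • -Complex.I • e = x.2.im • e - x.2.re • Complex.I • e := by
    rw [← Complex.coe_smul x.2.im, ← Complex.coe_smul x.2.re, smul_smul, smul_smul, ← sub_smul]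
    congr 1
    linear_combination Complex.I * Complex.re_add_im x.2 - x.2.im * Complex.I_sq
  rw [← hw]
  simp [frameMap, Fintype.linearCombination_apply]

theorem frameMap_inl_apply (f : Fin n → Cn1 n) (e : Cn1 n) (z : Fin n → ℂ) :
    frameMap f e (z, 0) = ∑ k, z k • f k := by
  simp [frameMap_apply]

theorem fderiv_frameMap_apply (hρ : IsLocalDefining M p ρ) (hp : p ∈ M) {f : Fin n → Cn1 n}
    (hf : ∀ k, f k ∈ complexTangentSpaceAt M p) {e : Cn1 n} (he : fderiv ℝ ρ p e = 1)
    (heI : fderiv ℝ ρ p (Complex.I • e) = 0) (x : Cn1 n) :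
    fderiv ℝ ρ p (frameMap f e x) = x.2.im := by
  have hsum := ((hρ.mem_complexTangentSpaceAt hp).1 (Submodule.sum_mem _
    fun k (_ : k ∈ Finset.univ) => Submodule.smul_mem _ (x.1 k) (hf k))).1
  rw [frameMap_apply, map_add, hsum, map_sub, map_smul, map_smul, he, heI]
  simp

theorem leviForm_sum_sum_of_orthonormal {f : Fin n → Cn1 n}
    (hL : ∀ k l, leviForm Θ p (f k) (f l) = if k = l then sgn ℓ k else 0) (z z' : Fin n → ℂ) :
    leviForm Θ p (∑ k, z k • f k) (∑ k, z' k • f k) = ∑ j, sgn ℓ j * (z j * conj (z' j)) := by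
  rw [leviForm_sum_sum]
  refine Finset.sum_congr rfl fun j _ => ?_
  simp only [hL, mul_ite, ite_mul, mul_zero, zero_mul, Finset.sum_ite_eq, Finset.mem_univ, if_true]
  ring

theorem frameMap_injective (hρ : IsLocalDefining M p ρ) (hp : p ∈ M) {f : Fin n → Cn1 n}
    (hf : ∀ k, f k ∈ complexTangentSpaceAt M p) {e : Cn1 n} (he : fderiv ℝ ρ p e = 1)
    (heI : fderiv ℝ ρ p (Complex.I • e) = 0)
    (hL : ∀ k l, leviForm Θ p (f k) (f l) = if k = l then sgn ℓ k else 0) :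
    Function.Injective (frameMap f e) := by
  refine (injective_iff_map_eq_zero _).2 fun x hx => ?_
  have him (c : ℂ) : (c * x.2).im = 0 := by
    rw [← smul_eq_mul, ← Prod.smul_snd, ← fderiv_frameMap_apply hρ hp hf he heI, map_smul, hx,
      smul_zero, map_zero]
  have hw : x.2 = 0 := Complex.ext (by simpa using him Complex.I) (by simpa using him 1)
  refine Prod.ext (funext fun k => ?_) hw
  obtain ⟨z, w⟩ := x
  obtain rfl : w = 0 := hw
  rw [frameMap_inl_apply] at hx
  have horth := leviForm_sum_sum_of_orthonormal hL z (Pi.single k 1)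
  have hzero (b : Cn1 n) : leviForm Θ p 0 b = 0 := by
    simpa using leviForm_smul_left Θ p 0 0 b
  rw [hx, hzero, Finset.sum_eq_single k (fun j _ hj => by simp [Pi.single_eq_of_ne hj]) (by simp)]
    at horth
  simpa [left_ne_zero_of_mul_eq_one (sgn_mul_self ℓ k)] using horth.symm

/-- In the complex linear coordinates `T` at `p`, the defining function has the 2-jet
`v - |z|_ℓ² + Re Q(z) + O(|w| |(z, w)|)` with `Q` a complex quadratic form, and the contact form is
`du / 2`. -/
structure IsAdaptedFrame (ℓ : ℕ) (ρ : Cn1 n → ℝ) (θ : tangentSpaceAt M p →ₗ[ℝ] ℝ)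
    (T : Cn1 n ≃L[ℂ] Cn1 n) : Prop where
  fderiv_apply : ∀ x, fderiv ℝ ρ p (T x) = x.2.im
  hess_apply : ∀ z, hess ρ p (T (z, 0)) (T (z, 0)) +
    hess ρ p (T (Complex.I • z, 0)) (T (Complex.I • z, 0)) = -4 * (normSqL ℓ z).re
  contactForm_apply : ∀ x (hx : T x ∈ tangentSpaceAt M p), θ ⟨T x, hx⟩ = x.2.re / 2

theorem IsAppropriateContactForm.exists_isAdaptedFrame (hθ : IsAppropriateContactForm M ℓ p θ)
    (hM : ∃ ρ, IsLocalDefining M p ρ) (hp : p ∈ M) :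
    ∃ ρ T, IsLocalDefining M p ρ ∧ IsAdaptedFrame ℓ ρ θ T := by
  obtain ⟨Θ, hΘ, f, hf, hL⟩ := hθ.exists_leviForm_orthonormal
  obtain ⟨ρ, e, hρ, he, heI, hΘe⟩ := hΘ.exists_isLocalDefining_normalized hθ.1 hM hp
  let T : Cn1 n ≃L[ℂ] Cn1 n := (LinearEquiv.ofInjectiveEndo (frameMap f e)
    (frameMap_injective hρ hp hf he heI hL)).toContinuousLinearEquiv
  have hT (x : Cn1 n) : T x = frameMap f e x := rfl
  have hDT (x : Cn1 n) : fderiv ℝ ρ p (T x) = x.2.im := fderiv_frameMap_apply hρ hp hf he heI x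
  have hmem (z : Fin n → ℂ) : ∑ k, z k • f k ∈ complexTangentSpaceAt M p :=
    Submodule.sum_mem _ fun k _ => Submodule.smul_mem _ _ (hf k)
  refine ⟨ρ, T, hρ, hDT, fun z => ?_, fun x hx => ?_⟩
  · have hI : T (Complex.I • z, 0) = Complex.I • T (z, 0) := by
      rw [← map_smul, Prod.smul_mk, smul_zero]
    have hlevi := hΘ.leviForm_self hρ hp he heI (hmem z)
    rw [leviForm_sum_sum_of_orthonormal hL] at hlevi
    change normSqL ℓ z = _ at hlevi
    rw [← normSqL_eq_re, Complex.ofReal_inj, hΘe] at hlevi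
    rw [hI, hT, frameMap_inl_apply, hlevi]
    ring
  · have him : x.2.im = 0 := by rw [← hDT, (hρ.mem_tangentSpaceAt hp).1 hx]
    rw [← hΘ.2, Subtype.coe_mk, hT, frameMap_apply, oneForm_add, oneForm_sub, oneForm_smul,
      oneForm_smul, hΘ.eventually_annihilates.self_of_nhds hp _ (hmem x.1), hΘe, him]
    simp only [smul_eq_mul]
    ring

end AdaptedFrame

/-! ### Graph charts and their holomorphic changes -/

section HermitianForm

variable {n : ℕ} {E : Type*} [NormedAddCommGroup E]

/-- `|z|_ℓ²` as a real number. -/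
def normSqRe (ℓ : ℕ) (z : Fin n → ℂ) : ℝ := (normSqL ℓ z).re

/-- The real symmetric bilinear form polarizing `|z|_ℓ²`. -/
def hermRe (ℓ : ℕ) (f z : Fin n → ℂ) : ℝ := (∑ j, sgn ℓ j * (f j * conj (z j))).re

theorem normSqRe_eq_hermRe (ℓ : ℕ) (z : Fin n → ℂ) : normSqRe ℓ z = hermRe ℓ z z := rfl

theorem hermRe_add (ℓ : ℕ) (f g z : Fin n → ℂ) :
    hermRe ℓ (f + g) z = hermRe ℓ f z + hermRe ℓ g z := by
  simp only [hermRe, Pi.add_apply, add_mul, mul_add, Finset.sum_add_distrib, Complex.add_re]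

theorem hermRe_comm (ℓ : ℕ) (f z : Fin n → ℂ) : hermRe ℓ f z = hermRe ℓ z f := by
  rw [hermRe, ← Complex.conj_re, map_sum, hermRe]
  congr 1
  refine Finset.sum_congr rfl fun j _ => ?_
  rw [map_mul, map_mul, conj_sgn, Complex.conj_conj, mul_comm (conj (f j))]

theorem normSqRe_add (ℓ : ℕ) (z f : Fin n → ℂ) :
    normSqRe ℓ (z + f) = normSqRe ℓ z + 2 * hermRe ℓ f z + normSqRe ℓ f := by
  simp only [normSqRe_eq_hermRe, hermRe_add]
  rw [hermRe_comm ℓ z (z + f), hermRe_comm ℓ f (z + f), hermRe_add, hermRe_add,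
    hermRe_comm ℓ z f]
  ring

theorem normSqRe_smul (ℓ : ℕ) (w : ℂ) (z : Fin n → ℂ) :
    normSqRe ℓ (w • z) = Complex.normSq w * normSqRe ℓ z := by
  rw [normSqRe, normSqRe, ← Complex.re_ofReal_mul, ← Complex.mul_conj, normSqL, normSqL,
    Finset.mul_sum]
  congr 1
  refine Finset.sum_congr rfl fun k _ => ?_
  rw [Pi.smul_apply, smul_eq_mul, map_mul]
  ring

theorem abs_hermRe_le (ℓ : ℕ) (f z : Fin n → ℂ) : |hermRe ℓ f z| ≤ n * (‖f‖ * ‖z‖) := by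
  refine (Complex.abs_re_le_norm _).trans ((norm_sum_le _ _).trans ?_)
  have hterm : ∀ j ∈ Finset.univ, ‖sgn ℓ j * (f j * conj (z j))‖ ≤ ‖f‖ * ‖z‖ := by
    intro j _
    have hsgn : ‖sgn ℓ j‖ = 1 := by
      unfold sgn
      split_ifs <;> simp
    rw [norm_mul, norm_mul, hsgn, one_mul, RCLike.norm_conj]
    exact mul_le_mul (norm_le_pi_norm f j) (norm_le_pi_norm z j) (norm_nonneg _) (norm_nonneg _)
  simpa using Finset.sum_le_card_nsmul _ _ _ hterm

theorem VanishesToOrder.hermRe {ℓ a b : ℕ} {f g : E → Fin n → ℂ}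
    (hf : VanishesToOrder a f) (hg : VanishesToOrder b g) :
    VanishesToOrder (a + b) fun y => hermRe ℓ (f y) (g y) := by
  refine IsBigO.trans (IsBigO.of_bound n (Eventually.of_forall fun y => ?_))
    (VanishesToOrder.mul hf.norm_left hg.norm_left)
  rw [norm_mul, norm_norm, norm_norm]
  exact abs_hermRe_le ℓ (f y) (g y)

theorem contDiff_normSqRe (ℓ : ℕ) : ContDiff ℝ ∞ (normSqRe ℓ : (Fin n → ℂ) → ℝ) := by
  have hconj : ∀ j, ContDiff ℝ ∞ fun z : Fin n → ℂ => conj (z j) := fun j =>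
    Complex.conjCLE.contDiff.comp (by fun_prop)
  exact Complex.reCLM.contDiff.comp
    (ContDiff.sum fun j _ => contDiff_const.mul (ContDiff.mul (by fun_prop) (hconj j)))

theorem vanishesToOrder_fst {F : Type*} [NormedAddCommGroup F] :
    VanishesToOrder 1 (Prod.fst : E × F → E) :=
  IsBigO.of_bound 1 (Eventually.of_forall fun y => by simpa using norm_fst_le y)

theorem vanishesToOrder_normSqRe_fst (ℓ : ℕ) : VanishesToOrder 2 fun y : CnR n => normSqRe ℓ y.1 :=
  vanishesToOrder_fst.hermRe vanishesToOrder_fst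

end HermitianForm

section Charts

variable {n : ℕ}

/-- In the coordinates given by the holomorphic map `Γ`, with `Γ 0 = p` and differential `T` at
`0`, the set `M` is near `0` the graph `v = φ(z, u)`. -/
structure IsGraphChart (M : Set (Cn1 n)) (p : Cn1 n) (T : Cn1 n ≃L[ℂ] Cn1 n)
    (Γ : Cn1 n → Cn1 n) (φ : CnR n → ℝ) : Prop where
  contDiff : ContDiff ℂ ∞ Γ
  apply_zero : Γ 0 = p
  hasFDerivAt : HasFDerivAt Γ (T : Cn1 n →L[ℂ] Cn1 n) 0
  smooth : ∀ᶠ y in 𝓝 0, ContDiffAt ℝ ∞ φ y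
  zero : φ 0 = 0
  mem_iff : ∀ᶠ x in 𝓝 0, (Γ x ∈ M ↔ x.2.im = φ (x.1, x.2.re))

/-- The function `v - φ(z, u)`. -/
def graphDefect (φ : CnR n → ℝ) (x : Cn1 n) : ℝ := x.2.im - φ (x.1, x.2.re)

theorem eventually_contDiffAt_graphDefect {φ : CnR n → ℝ}
    (hφ : ∀ᶠ y in 𝓝 0, ContDiffAt ℝ ∞ φ y) :
    ∀ᶠ x in 𝓝 0, ContDiffAt ℝ ∞ (graphDefect φ) x := by
  have hcoords : ContDiff ℝ ∞ (graphCoords n) := (graphCoords n).contDiff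
  have htendsto : Tendsto (fun x => (graphCoords n x).1) (𝓝 0) (𝓝 0) := by
    simpa using hcoords.continuous.fst.tendsto 0
  filter_upwards [htendsto.eventually hφ] with x hx
  exact hcoords.contDiffAt.snd.sub (hx.comp x hcoords.contDiffAt.fst)

theorem hasFDerivAt_graphDefect {φ : CnR n → ℝ} (hφ : VanishesToOrder 2 φ) :
    HasFDerivAt (graphDefect φ) (Complex.imCLM ∘L .snd ℝ (Fin n → ℂ) ℂ) 0 := by
  have hcoords : HasFDerivAt (graphCoords n) (graphCoords n : Cn1 n →L[ℝ] CnR n × ℝ) 0 :=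
    (graphCoords n).hasFDerivAt
  have hφ0 : HasFDerivAt φ (0 : CnR n →L[ℝ] ℝ) (graphCoords n 0).1 := by
    simpa using hφ.hasFDerivAt_zero (𝕜 := ℝ) one_lt_two
  have hφcoords := HasFDerivAt.comp (f := fun x => (graphCoords n x).1) 0 hφ0 hcoords.fst
  refine (hcoords.snd.sub hφcoords).congr_fderiv ?_
  ext x <;> simp [graphCoords_apply]

theorem IsGraphChart.change {M : Set (Cn1 n)} {p : Cn1 n} {T : Cn1 n ≃L[ℂ] Cn1 n}
    {Γ : Cn1 n → Cn1 n} {φ : CnR n → ℝ} (h : IsGraphChart M p T Γ φ)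
    (hφ : VanishesToOrder 2 φ) {G : Cn1 n → Cn1 n} (hG : ContDiff ℂ ∞ G) (hG0 : G 0 = 0)
    (hG' : HasFDerivAt G (ContinuousLinearMap.id ℂ (Cn1 n)) 0) {N : CnR n → ℝ}
    (hN : Tendsto N (𝓝 0) (𝓝 0)) {k : ℕ}
    (hk : VanishesToOrder k fun y => graphDefect φ (G (pointOver y (N y)))) :
    ∃ φ', IsGraphChart M p T (Γ ∘ G) φ' ∧ VanishesToOrder k fun y => φ' y - N y := by
  have hGt : Tendsto G (𝓝 0) (𝓝 0) := by
    simpa only [hG0] using hG.continuous.tendsto 0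
  have hsmooth : ∀ᶠ x in 𝓝 0, ContDiffAt ℝ ∞ (graphDefect φ ∘ G) x :=
    (hGt.eventually (eventually_contDiffAt_graphDefect h.smooth)).mono fun x hx =>
      hx.comp x (hG.restrict_scalars ℝ).contDiffAt
  have hfderiv : ∀ x, fderiv ℝ (graphDefect φ ∘ G) 0 x = x.2.im := by
    intro x
    have hdefect := hasFDerivAt_graphDefect hφ
    rw [← hG0] at hdefect
    rw [(hdefect.comp 0 (hG'.restrictScalars ℝ)).fderiv]
    rfl
  have hdefect0 : (graphDefect φ ∘ G) 0 = 0 := by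
    rw [Function.comp_apply, hG0]
    exact (zero_sub _).trans (neg_eq_zero.2 h.zero)
  obtain ⟨φ', hφ', h0, hO, hiff⟩ :=
    exists_graph hsmooth hdefect0 hfderiv hN hk
  refine ⟨φ', ⟨h.contDiff.comp hG, by simp [hG0, h.apply_zero], ?_, hφ', h0, ?_⟩, hO⟩
  · have hΓ : HasFDerivAt Γ (T : Cn1 n →L[ℂ] Cn1 n) (G 0) := by
      rw [hG0]
      exact h.hasFDerivAt
    exact hΓ.comp 0 hG'
  · filter_upwards [hGt.eventually h.mem_iff, hiff] with x hx₁ hx₂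
    rw [Function.comp_apply, hx₁, ← hx₂, Function.comp_apply, graphDefect, sub_eq_zero]

theorem vanishesToOrder_comp_pointOver {E : Type*} [NormedAddCommGroup E] {k : ℕ} {f : Cn1 n → E}
    {N : CnR n → ℝ} (hf : VanishesToOrder k f) (hN : VanishesToOrder 1 N) :
    VanishesToOrder k fun y => f (pointOver y (N y)) := by
  simpa only [one_mul, Function.comp_def] using
    VanishesToOrder.comp hf hN.pointOver one_ne_zero

theorem vanishesToOrder_graphDefect_shift {ℓ d : ℕ} {φ : CnR n → ℝ}
    (m : ContinuousMultilinearMap ℝ (fun _ : Fin (d + 1) => CnR n) ℝ)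
    (hφ : VanishesToOrder (d + 2) fun y => φ y - (normSqRe ℓ y.1 + m fun _ => y))
    {f : Cn1 n → Fin n → ℂ} {g : Cn1 n → ℂ} (hf : VanishesToOrder 2 f)
    (hg : VanishesToOrder 2 g) {N : CnR n → ℝ} (hN : VanishesToOrder 1 N)
    (hK : VanishesToOrder (d + 2) fun y => N y + (g (pointOver y (N y))).im
      - normSqRe ℓ (y.1 + f (pointOver y (N y))) - m fun _ => y) :
    VanishesToOrder (d + 2) fun y =>
      graphDefect φ (pointOver y (N y) + (f (pointOver y (N y)), g (pointOver y (N y)))) := by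
  let δ : CnR n → CnR n := fun y => (f (pointOver y (N y)), (g (pointOver y (N y))).re)
  have hδ : VanishesToOrder 2 δ :=
    (vanishesToOrder_comp_pointOver hf hN).prod_left <| IsBigO.trans
      (IsBigO.of_bound 1 (Eventually.of_forall fun y => by
        simpa using Complex.abs_re_le_norm (g (pointOver y (N y)))))
      (vanishesToOrder_comp_pointOver hg hN)
  have hid : VanishesToOrder 1 fun y : CnR n => y := by
    simpa [VanishesToOrder] using (isBigO_refl (fun y : CnR n => y) (𝓝 0)).norm_right
  have hsum : VanishesToOrder 1 fun y => y + δ y := hid.add (hδ.of_le one_le_two)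
  have hshift := vanishesToOrder_multilinear_diag_sub m hsum hid
    (by simpa only [add_sub_cancel_left] using hδ)
  have hφδ : VanishesToOrder (d + 2) fun y =>
      φ (y + δ y) - (normSqRe ℓ (y + δ y).1 + m fun _ => y + δ y) := by
    simpa only [one_mul, Function.comp_def] using VanishesToOrder.comp hφ hsum one_ne_zero
  refine ((IsBigO.sub hK hshift).sub hφδ).congr_left fun y => ?_
  have hdefect : graphDefect φ (pointOver y (N y) +
      (f (pointOver y (N y)), g (pointOver y (N y)))) =
      N y + (g (pointOver y (N y))).im - φ (y + δ y) := rfl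
  have hfst : (y + δ y).1 = y.1 + f (pointOver y (N y)) := rfl
  rw [hdefect, hfst]
  ring

theorem IsGraphChart.normalize {M : Set (Cn1 n)} {p : Cn1 n} {T : Cn1 n ≃L[ℂ] Cn1 n}
    {Γ : Cn1 n → Cn1 n} {φ : CnR n → ℝ} (h : IsGraphChart M p T Γ φ) {ℓ d : ℕ}
    (m : ContinuousMultilinearMap ℝ (fun _ : Fin (d + 2) => CnR n) ℝ)
    (hφ : VanishesToOrder (d + 3) fun y => φ y - (normSqRe ℓ y.1 + m fun _ => y))
    {f : Cn1 n → Fin n → ℂ} {g : Cn1 n → ℂ} (hf : ContDiff ℂ ∞ f) (hg : ContDiff ℂ ∞ g)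
    (hfO : VanishesToOrder 2 f) (hgO : VanishesToOrder 2 g)
    {N : CnR n → ℝ} (hN : VanishesToOrder 1 N)
    (hK : VanishesToOrder (d + 3) fun y => N y + (g (pointOver y (N y))).im
      - normSqRe ℓ (y.1 + f (pointOver y (N y))) - m fun _ => y) :
    ∃ Γ' φ', IsGraphChart M p T Γ' φ' ∧ VanishesToOrder (d + 3) fun y => φ' y - N y := by
  have hφ2 : VanishesToOrder 2 φ := by
    have hm := (vanishesToOrder_multilinear_diag m).of_le (Nat.le_add_left 2 d)
    refine (((hφ.of_le (by omega)).add (vanishesToOrder_normSqRe_fst ℓ)).add hm).congr_left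
      fun y => ?_
    ring
  have hfg : VanishesToOrder 2 fun x => (f x, g x) := hfO.prod_left hgO
  have hfg' : HasFDerivAt (fun x => x + (f x, g x)) (ContinuousLinearMap.id ℂ (Cn1 n)) 0 :=
    ((hasFDerivAt_id (𝕜 := ℂ) (0 : Cn1 n)).fun_add
      (VanishesToOrder.hasFDerivAt_zero hfg one_lt_two)).congr_fderiv (add_zero _)
  obtain ⟨φ', hφ', hO⟩ := h.change hφ2 (contDiff_id.add (hf.prodMk hg))
    (by simpa using hfg.apply_zero two_ne_zero) hfg' (hN.tendsto_zero one_ne_zero)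
    (vanishesToOrder_graphDefect_shift m hφ hfO hgO hN hK)
  exact ⟨_, φ', hφ', hO⟩

end Charts

/-! ### Splitting of homogeneous polynomials -/

section HolomorphicForms

variable {E F : Type*} [NormedAddCommGroup E] [NormedSpace ℂ E] [NormedAddCommGroup F]
  [NormedSpace ℂ F] {k : ℕ}

/-- `g` is a holomorphic map that is homogeneous of degree `k`. -/
structure IsHolHomogeneous (k : ℕ) (g : E → F) : Prop where
  contDiff : ContDiff ℂ ∞ g
  map_smul : ∀ (c : ℂ) x, g (c • x) = c ^ k • g x

theorem isHolHomogeneous_clm (A : E →L[ℂ] F) : IsHolHomogeneous 1 A :=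
  ⟨A.contDiff, fun c x => by rw [map_smul, pow_one]⟩

namespace IsHolHomogeneous

theorem zero (k : ℕ) : IsHolHomogeneous k (0 : E → F) :=
  ⟨contDiff_const, fun _ _ => (smul_zero _).symm⟩

theorem const (a : F) : IsHolHomogeneous 0 fun _ : E => a :=
  ⟨contDiff_const, fun _ _ => by rw [pow_zero, one_smul]⟩

theorem add {g h : E → F} (hg : IsHolHomogeneous k g) (hh : IsHolHomogeneous k h) :
    IsHolHomogeneous k (g + h) :=
  ⟨hg.contDiff.add hh.contDiff, fun c x => by
    rw [Pi.add_apply, Pi.add_apply, hg.map_smul, hh.map_smul, smul_add]⟩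

theorem smul {m : ℕ} {g : E → ℂ} {h : E → F} (hg : IsHolHomogeneous k g)
    (hh : IsHolHomogeneous m h) : IsHolHomogeneous (k + m) (g • h) :=
  ⟨hg.contDiff.smul hh.contDiff, fun c x => by
    rw [Pi.smul_apply', Pi.smul_apply', hg.map_smul, hh.map_smul, smul_eq_mul, pow_add,
      smul_smul, smul_smul]
    ring_nf⟩

theorem const_smul {g : E → F} (hg : IsHolHomogeneous k g) (a : ℂ) :
    IsHolHomogeneous k (a • g) :=
  ⟨contDiff_const.smul hg.contDiff, fun c x => by
    rw [Pi.smul_apply, Pi.smul_apply, hg.map_smul, smul_comm]⟩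

variable {g : E → F}

theorem map_real_smul (hg : IsHolHomogeneous k g) (t : ℝ) (x : E) :
    g (t • x) = t ^ k • g x := by
  simpa only [Complex.coe_smul, ← Complex.ofReal_pow] using hg.map_smul t x

theorem vanishesToOrder (hg : IsHolHomogeneous k g) : VanishesToOrder k g :=
  .of_homogeneous hg.contDiff.continuous.continuousAt hg.map_real_smul

theorem vanishesToOrder_sub [CompleteSpace F] {G : Type*} [NormedAddCommGroup G] {m : ℕ}
    (hg : IsHolHomogeneous (k + 1) g) {a b : G → E} (ha : VanishesToOrder 1 a)
    (hb : VanishesToOrder 1 b) (hab : VanishesToOrder m fun x => a x - b x) :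
    VanishesToOrder (k + m) fun x => g (a x) - g (b x) := by
  have hsmooth : ContDiffAt ℝ (k + 1 + 1) g 0 :=
    ((hg.contDiff.restrict_scalars ℝ).of_le (by exact_mod_cast le_top)).contDiffAt
  have hdiag := eq_iteratedFDeriv_diag_of_homogeneous (d := k + 1) hsmooth hg.map_real_smul
  refine IsBigO.congr_left ((vanishesToOrder_multilinear_diag_sub
    (iteratedFDeriv ℝ (k + 1) g 0) ha hb hab).const_smul_left ((k + 1).factorial : ℝ)⁻¹)
    fun x => ?_
  rw [hdiag (a x), hdiag (b x), ← smul_sub]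
  rfl

end IsHolHomogeneous

variable {n : ℕ}

theorem IsHolHomogeneous.vanishesToOrder_sub_pointOver [CompleteSpace F] {g : Cn1 n → F}
    (hg : IsHolHomogeneous (k + 1) g) {N : CnR n → ℝ} (hN : VanishesToOrder 2 N) :
    VanishesToOrder (k + 2) fun y => g (pointOver y (N y)) - g (pointOver y 0) :=
  hg.vanishesToOrder_sub (VanishesToOrder.pointOver (hN.of_le one_le_two))
    vanishesToOrder_pointOver_zero (vanishesToOrder_pointOver_sub hN)

/-- The holomorphic monomial `z_{K₁} ⋯ z_{K_r} w ^ c`. -/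
def holMonomial (K : List (Fin n)) (c : ℕ) (x : Cn1 n) : ℂ := (K.map x.1).prod * x.2 ^ c

theorem isHolHomogeneous_holMonomial (K : List (Fin n)) (c : ℕ) :
    IsHolHomogeneous (K.length + c) (holMonomial K c) := by
  refine IsHolHomogeneous.smul (g := fun x : Cn1 n => (K.map x.1).prod) ?_ ?_
  · induction K with
    | nil => simpa using IsHolHomogeneous.const 1
    | cons j K ih =>
      rw [List.length_cons, add_comm]
      exact (isHolHomogeneous_clm (.proj j ∘L .fst ℂ (Fin n → ℂ) ℂ)).smul ih
  · induction c with
    | zero => simpa using IsHolHomogeneous.const 1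
    | succ c ih =>
      simp only [pow_succ]
      exact ih.smul (isHolHomogeneous_clm (.snd ℂ (Fin n → ℂ) ℂ))

end HolomorphicForms

section Splitting

variable {n : ℕ} {ℓ e : ℕ} {Q Q' : CnR n → ℂ}

/-- `Re Q = Im g(z, u) - 2 Re ⟨f(z, u), z⟩_ℓ + Re s(z, z̄)` with holomorphic homogeneous `g` of
degree `e + 1` and `f` of degree `e`. The first two terms are the effect on the equation
`v = |z|_ℓ²` of the change of coordinates `(z, w) ↦ (z + f, w + g)`. The quartic term is absent in
degrees below `4`, and `f` does not depend on `w` in degree `2`. -/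
def HasSplitting (ℓ e : ℕ) (Q : CnR n → ℂ) : Prop :=
  ∃ (g : Cn1 n → ℂ) (f : Cn1 n → Fin n → ℂ) (s : Fin n → Fin n → Fin n → Fin n → ℂ),
    IsHolHomogeneous (e + 1) g ∧ IsHolHomogeneous e f ∧ (e ≤ 2 → s = 0) ∧
    (e = 1 → ∀ x, f x = f (x.1, 0)) ∧
    ∀ y, (Q y).re = (g (pointOver y 0)).im - 2 * hermRe ℓ (f (pointOver y 0)) y.1
      + (quartic s y.1).re

theorem quartic_zero (z : Fin n → ℂ) : quartic 0 z = 0 := by simp [quartic]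

theorem quartic_add (s t : Fin n → Fin n → Fin n → Fin n → ℂ) (z : Fin n → ℂ) :
    quartic (s + t) z = quartic s z + quartic t z := by
  simp only [quartic, Pi.add_apply, add_mul, Finset.sum_add_distrib]

theorem hermRe_zero (ℓ : ℕ) (z : Fin n → ℂ) : hermRe ℓ 0 z = 0 := by simp [hermRe]

theorem HasSplitting.add (h : HasSplitting ℓ e Q) (h' : HasSplitting ℓ e Q') :
    HasSplitting ℓ e (Q + Q') := by
  obtain ⟨g, f, s, hg, hf, hs, hw, h⟩ := h
  obtain ⟨g', f', s', hg', hf', hs', hw', h'⟩ := h'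
  refine ⟨g + g', f + f', s + s', hg.add hg', hf.add hf',
    fun he => by rw [hs he, hs' he, add_zero], fun he x => ?_, fun y => ?_⟩
  · exact congrArg₂ (· + ·) (hw he x) (hw' he x)
  · simp only [Pi.add_apply, Complex.add_re, Complex.add_im, h, h', quartic_add, hermRe_add]
    ring

theorem HasSplitting.congr (h : HasSplitting ℓ e Q) (hQ : ∀ y, (Q' y).re = (Q y).re) :
    HasSplitting ℓ e Q' := by
  obtain ⟨g, f, s, hg, hf, hs, hw, h⟩ := h
  exact ⟨g, f, s, hg, hf, hs, hw, fun y => (hQ y).trans (h y)⟩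

theorem hasSplitting_zero : HasSplitting ℓ e (0 : CnR n → ℂ) :=
  ⟨0, 0, 0, .zero _, .zero _, fun _ => rfl, fun _ _ => rfl, fun y => by
    simp [quartic_zero, hermRe_zero]⟩

/-- The monomial `z_{K₁} ⋯ z_{K_r} z̄_{L₁} ⋯ z̄_{L_t} u ^ c`. -/
def realMonomial (K L : List (Fin n)) (c : ℕ) (y : CnR n) : ℂ :=
  (K.map y.1).prod * conj (L.map y.1).prod * (y.2 : ℂ) ^ c

theorem conj_realMonomial (K L : List (Fin n)) (c : ℕ) (y : CnR n) :
    conj (realMonomial K L c y) = realMonomial L K c y := by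
  simp only [realMonomial, map_mul, map_pow, Complex.conj_conj, Complex.conj_ofReal]
  ring

theorem HasSplitting.swap {a : ℂ} {K L : List (Fin n)} {c : ℕ}
    (h : HasSplitting ℓ e (conj a • realMonomial L K c)) :
    HasSplitting ℓ e (a • realMonomial K L c) :=
  h.congr fun y => by
    rw [← Complex.conj_re, Pi.smul_apply, Pi.smul_apply, smul_eq_mul, smul_eq_mul, map_mul,
      conj_realMonomial]

theorem hasSplitting_realMonomial_nil (a : ℂ) {K : List (Fin n)} {c : ℕ}
    (hK : K.length + c = e + 1) : HasSplitting ℓ e (a • realMonomial K [] c) := by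
  refine ⟨(Complex.I * a) • holMonomial K c, 0, 0,
    (hK ▸ isHolHomogeneous_holMonomial K c).const_smul _, .zero e, fun _ => rfl,
    fun _ _ => rfl, fun y => ?_⟩
  have hhol : holMonomial K c (pointOver y 0) = realMonomial K [] c y := by
    simp [holMonomial, realMonomial, pointOver, ← Complex.ofReal_def]
  rw [Pi.smul_apply, Pi.smul_apply, hhol, Pi.zero_apply, hermRe_zero, quartic_zero, smul_eq_mul,
    smul_eq_mul, mul_assoc, Complex.I_mul_im]
  simp

theorem hermRe_single (ℓ : ℕ) (β : Fin n) (a : ℂ) (z : Fin n → ℂ) :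
    hermRe ℓ (Pi.single β a) z = (sgn ℓ β * (a * conj (z β))).re := by
  rw [hermRe, Finset.sum_eq_single β (fun j _ hj => by simp [Pi.single_eq_of_ne hj]) (by simp),
    Pi.single_eq_same]

theorem hasSplitting_realMonomial_singleton (a : ℂ) {K : List (Fin n)} (β : Fin n) {c : ℕ}
    (hK : K.length + c = e) (hK0 : K ≠ []) : HasSplitting ℓ e (a • realMonomial K [β] c) := by
  refine ⟨0, (-(1 / 2) * sgn ℓ β * a) • (holMonomial K c • fun _ => Pi.single β 1), 0, .zero _,
    ((hK ▸ isHolHomogeneous_holMonomial K c).smul (.const _)).const_smul _, fun _ => rfl,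
    fun he x => ?_, fun y => ?_⟩
  · have hc : c = 0 := by
      have := List.length_pos_of_ne_nil hK0
      omega
    simp [holMonomial, hc]
  · have hhol : holMonomial K c (pointOver y 0) = (K.map y.1).prod * (y.2 : ℂ) ^ c := rfl
    have hsingle (b : ℂ) : b • (Pi.single β 1 : Fin n → ℂ) = Pi.single β b := by
      rw [← Pi.single_smul, smul_eq_mul, mul_one]
    rw [Pi.smul_apply, Pi.smul_apply, Pi.smul_apply', hhol, smul_smul, hsingle, hermRe_single,
      quartic_zero, Pi.zero_apply, Complex.zero_im, Complex.zero_re, zero_sub, add_zero,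
      ← neg_mul, ← Complex.re_ofReal_mul, smul_eq_mul, realMonomial]
    congr 1
    simp only [List.map_cons, List.map_nil, List.prod_singleton]
    push_cast
    linear_combination (-a * ((K.map y.1).prod * conj (y.1 β) * (y.2 : ℂ) ^ c)) * sgn_mul_self ℓ β

theorem hasSplitting_realMonomial_pair (a : ℂ) (α β γ δ : Fin n) :
    HasSplitting ℓ 3 (a • realMonomial [α, γ] [β, δ] 0) := by
  refine ⟨0, 0, Pi.single α (Pi.single β (Pi.single γ (Pi.single δ a))), .zero _, .zero _,
    fun h => absurd h (by norm_num), fun h => absurd h (by norm_num), fun y => ?_⟩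
  have hquartic : quartic (Pi.single α (Pi.single β (Pi.single γ (Pi.single δ a)))) y.1 =
      a * (y.1 α * conj (y.1 β) * y.1 γ * conj (y.1 δ)) := by
    simp [quartic, Pi.single_apply, ite_apply]
  simp only [hquartic, realMonomial, Pi.smul_apply, Pi.zero_apply, hermRe_zero, Complex.zero_im,
    mul_zero, sub_zero, zero_add]
  congr 1
  simp only [List.map_cons, List.map_nil, List.prod_cons, List.prod_nil, map_mul, mul_one,
    pow_zero, smul_eq_mul]
  ring

theorem hasSplitting_realMonomial (he : e ≤ 3) (a : ℂ) (K L : List (Fin n)) (c : ℕ)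
    (hlen : K.length + L.length + c = e + 1) : HasSplitting ℓ e (a • realMonomial K L c) := by
  wlog hLK : L.length ≤ K.length generalizing a K L
  · exact (this (conj a) L K (by omega) (by omega)).swap
  match K, L with
  | K, [] => exact hasSplitting_realMonomial_nil a (by simpa using hlen)
  | α :: K, [β] =>
    refine hasSplitting_realMonomial_singleton a β ?_ (List.cons_ne_nil α K)
    simp only [List.length_cons, List.length_nil] at hlen ⊢
    omega
  | [α, γ], [β, δ] =>
    simp only [List.length_cons, List.length_nil] at hlen
    obtain ⟨rfl, rfl⟩ : e = 3 ∧ c = 0 := by omega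
    exact hasSplitting_realMonomial_pair a α β γ δ
  | [], _ :: _ => simp at hLK
  | [_], _ :: _ :: _ => simp at hLK
  | _ :: _ :: _ :: _, _ :: _ :: _ | [_, _], _ :: _ :: _ :: _ =>
    simp only [List.length_cons] at hlen
    omega

end Splitting

section RealForms

open scoped Pointwise

variable {n : ℕ}

/-- The coordinate functions `z_j`, `z̄_j` and `u` on `ℂⁿ × ℝ`. -/
def coordFunctions (n : ℕ) : Set (CnR n → ℂ) :=
  (Set.range fun j y => y.1 j) ∪ (Set.range fun j y => conj (y.1 j)) ∪ {fun y => (y.2 : ℂ)}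

theorem exists_realMonomial_of_mem_pow {d : ℕ} {Q : CnR n → ℂ} (hQ : Q ∈ coordFunctions n ^ d) :
    ∃ K L c, K.length + L.length + c = d ∧ Q = realMonomial K L c := by
  induction d generalizing Q with
  | zero =>
    rw [pow_zero, Set.mem_one] at hQ
    exact ⟨[], [], 0, rfl, by ext; simp [hQ, realMonomial]⟩
  | succ d ih =>
    rw [pow_succ, Set.mem_mul] at hQ
    obtain ⟨Q', hQ', x, hx, rfl⟩ := hQ
    obtain ⟨K, L, c, hlen, rfl⟩ := ih hQ'
    rcases hx with (⟨j, rfl⟩ | ⟨j, rfl⟩) | rfl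
    · refine ⟨j :: K, L, c, by rw [List.length_cons]; omega, funext fun y => ?_⟩
      simp only [realMonomial, Pi.mul_apply, List.map_cons, List.prod_cons]
      ring
    · refine ⟨K, j :: L, c, by rw [List.length_cons]; omega, funext fun y => ?_⟩
      simp only [realMonomial, Pi.mul_apply, List.map_cons, List.prod_cons, map_mul]
      ring
    · refine ⟨K, L, c + 1, by omega, funext fun y => ?_⟩
      simp only [realMonomial, Pi.mul_apply, pow_succ]
      ring

theorem ofReal_realLinearMap_apply (μ : ℂ →ₗ[ℝ] ℝ) (z : ℂ) :
    (μ z : ℂ) = (μ 1 - Complex.I * μ Complex.I) / 2 * z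
      + (μ 1 + Complex.I * μ Complex.I) / 2 * conj z := by
  have hz : μ z = z.re * μ 1 + z.im * μ Complex.I := by
    rw [← smul_eq_mul, ← smul_eq_mul, ← map_smul, ← map_smul, ← map_add]
    congr 1
    simp
  rw [hz, Complex.ofReal_add, Complex.ofReal_mul, Complex.ofReal_mul, Complex.re_eq_add_conj,
    Complex.im_eq_sub_conj]
  field_simp
  linear_combination (z - conj z) * μ Complex.I * Complex.I_sq

theorem realLinearMap_mem_span_coordFunctions (μ : CnR n →ₗ[ℝ] ℝ) :
    (fun y => (μ y : ℂ)) ∈ Submodule.span ℂ (coordFunctions n) := by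
  let ν (j : Fin n) : ℂ →ₗ[ℝ] ℝ := μ ∘ₗ .inl ℝ (Fin n → ℂ) ℝ ∘ₗ .single ℝ (fun _ => ℂ) j
  have hμ : (fun y => (μ y : ℂ)) = (∑ j,
      ((((ν j 1 - Complex.I * ν j Complex.I) / 2 : ℂ) • fun y : CnR n => y.1 j)
        + ((ν j 1 + Complex.I * ν j Complex.I) / 2 : ℂ) • fun y : CnR n => conj (y.1 j)))
      + (μ (0, 1) : ℂ) • fun y : CnR n => (y.2 : ℂ) := by
    funext y
    have hy : μ y = ∑ j, ν j (y.1 j) + y.2 * μ (0, 1) := by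
      have hsplit : y = ((∑ j, Pi.single j (y.1 j), 0) : CnR n) + y.2 • (0, 1) := by
        rw [Finset.univ_sum_single]
        ext <;> simp
      conv_lhs => rw [hsplit, map_add, map_smul, smul_eq_mul]
      congr 1
      exact map_sum (μ ∘ₗ .inl ℝ (Fin n → ℂ) ℝ) (fun j => Pi.single j (y.1 j)) .univ
    rw [hy, Complex.ofReal_add, Complex.ofReal_sum, Complex.ofReal_mul, mul_comm (y.2 : ℂ),
      Pi.add_apply, Finset.sum_apply]
    exact congrArg (· + _) (Finset.sum_congr rfl fun j _ => ofReal_realLinearMap_apply (ν j) _)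
  have hmem {q : CnR n → ℂ} (hq : q ∈ coordFunctions n) (a : ℂ) :
      a • q ∈ Submodule.span ℂ (coordFunctions n) :=
    Submodule.smul_mem _ _ (Submodule.subset_span hq)
  rw [hμ]
  exact add_mem (sum_mem fun j _ => add_mem (hmem (.inl (.inl ⟨j, rfl⟩)) _)
    (hmem (.inl (.inr ⟨j, rfl⟩)) _)) (hmem (.inr rfl) _)

theorem prod_mem_submodule_pow {R A : Type*} [CommSemiring R] [CommSemiring A] [Algebra R A]
    {S : Submodule R A} {d : ℕ} {q : Fin d → A} (hq : ∀ k, q k ∈ S) : ∏ k, q k ∈ S ^ d := by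
  induction d with
  | zero => exact Submodule.mem_one.2 ⟨1, by simp⟩
  | succ d ih =>
    rw [Fin.prod_univ_castSucc, pow_succ]
    exact Submodule.mul_mem_mul (ih fun k => hq _) (hq _)

theorem multilinear_diag_mem_span_coordFunctions_pow {d : ℕ}
    (m : MultilinearMap ℝ (fun _ : Fin d => CnR n) ℝ) :
    (fun y => ((m fun _ => y : ℝ) : ℂ)) ∈ Submodule.span ℂ (coordFunctions n) ^ d := by
  let b := Module.finBasis ℝ (CnR n)
  have hexpand : (fun y => ((m fun _ => y : ℝ) : ℂ)) =
      ∑ κ : Fin d → Fin (Module.finrank ℝ (CnR n)),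
        ((m fun k => b (κ k) : ℝ) : ℂ) • ∏ k, fun y => ((b.coord (κ k) y : ℝ) : ℂ) := by
    funext y
    have hy : (fun _ : Fin d => y) = fun _ => ∑ i, b.coord i y • b i :=
      funext fun _ => (b.sum_repr y).symm
    rw [hy, m.map_sum, Complex.ofReal_sum, Finset.sum_apply]
    refine Finset.sum_congr rfl fun κ _ => ?_
    rw [m.map_smul_univ, Pi.smul_apply, Finset.prod_apply, smul_eq_mul, smul_eq_mul,
      Complex.ofReal_mul, Complex.ofReal_prod, mul_comm]
  rw [hexpand]
  exact sum_mem fun κ _ => Submodule.smul_mem _ _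
    (prod_mem_submodule_pow fun k => realLinearMap_mem_span_coordFunctions _)

theorem hasSplitting_multilinear_diag (ℓ : ℕ) {e : ℕ} (he : e ≤ 3)
    (m : MultilinearMap ℝ (fun _ : Fin (e + 1) => CnR n) ℝ) :
    HasSplitting ℓ e fun y => ((m fun _ => y : ℝ) : ℂ) := by
  have hspan : ∀ Q ∈ Submodule.span ℂ (coordFunctions n ^ (e + 1)), ∀ a : ℂ,
      HasSplitting ℓ e (a • Q) := by
    intro Q hQ
    induction hQ using Submodule.span_induction with
    | mem Q hQ =>
      obtain ⟨K, L, c, hlen, rfl⟩ := exists_realMonomial_of_mem_pow hQ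
      exact fun a => hasSplitting_realMonomial he a K L c hlen
    | zero => exact fun a => by simpa only [smul_zero] using hasSplitting_zero
    | add Q Q' _ _ h h' => exact fun a => by simpa only [smul_add] using (h a).add (h' a)
    | smul c Q _ h => exact fun a => by simpa only [smul_smul] using h (a * c)
  have hmem := multilinear_diag_mem_span_coordFunctions_pow m
  rw [Submodule.span_pow] at hmem
  simpa only [one_smul] using hspan _ hmem 1

end RealForms

/-! ### Quartic forms and their traces -/

section Polarization

variable {n : ℕ}

/-- The polarization `∑ s_{αβ̄γδ̄} a_α b̄_β c_γ d̄_δ` of the form `quartic s`. -/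
def polar (s : Fin n → Fin n → Fin n → Fin n → ℂ) (a b c d : Fin n → ℂ) : ℂ :=
  ∑ α, ∑ β, ∑ γ, ∑ δ, s α β γ δ * (a α * conj (b β) * c γ * conj (d δ))

variable (s : Fin n → Fin n → Fin n → Fin n → ℂ) (a b c d : Fin n → ℂ)

theorem quartic_eq_polar (z : Fin n → ℂ) : quartic s z = polar s z z z z := rfl

theorem polar_smul (p q r t : ℂ) :
    polar s (p • a) (q • b) (r • c) (t • d) = p * conj q * r * conj t * polar s a b c d := by
  simp only [polar, Finset.mul_sum, Pi.smul_apply, smul_eq_mul, map_mul]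
  refine Finset.sum_congr rfl fun α _ => Finset.sum_congr rfl fun β _ =>
    Finset.sum_congr rfl fun γ _ => Finset.sum_congr rfl fun δ _ => ?_
  ring

theorem polar_swap_left : polar (fun α β γ δ => s γ β α δ) a b c d = polar s c b a d := by
  unfold polar
  calc
    _ = ∑ α, ∑ γ, ∑ β, ∑ δ, s γ β α δ * (a α * conj (b β) * c γ * conj (d δ)) :=
      Finset.sum_congr rfl fun α _ => Finset.sum_comm
    _ = ∑ γ, ∑ α, ∑ β, ∑ δ, s γ β α δ * (a α * conj (b β) * c γ * conj (d δ)) := Finset.sum_comm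
    _ = ∑ γ, ∑ β, ∑ α, ∑ δ, s γ β α δ * (a α * conj (b β) * c γ * conj (d δ)) :=
      Finset.sum_congr rfl fun γ _ => Finset.sum_comm
    _ = _ := by
      refine Finset.sum_congr rfl fun γ _ => Finset.sum_congr rfl fun β _ =>
        Finset.sum_congr rfl fun α _ => Finset.sum_congr rfl fun δ _ => ?_
      ring

theorem conj_polar :
    conj (polar s a b c d) = polar (fun α β γ δ => conj (s β α δ γ)) b a d c := by
  simp only [polar, map_sum, map_mul, Complex.conj_conj]
  rw [Finset.sum_comm]
  refine Finset.sum_congr rfl fun β _ => Finset.sum_congr rfl fun α _ => ?_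
  rw [Finset.sum_comm]
  refine Finset.sum_congr rfl fun δ _ => Finset.sum_congr rfl fun γ _ => ?_
  ring

theorem quartic_eq_re (hs : ∀ α β γ δ, conj (s α β γ δ) = s β α δ γ) (z : Fin n → ℂ) :
    ((quartic s z).re : ℂ) = quartic s z := by
  rw [← Complex.conj_eq_iff_re, quartic_eq_polar, conj_polar]
  simp only [hs]

theorem polar_swap_right : polar (fun α β γ δ => s α δ γ β) a b c d = polar s a d c b := by
  apply (starRingEnd ℂ).injective
  rw [conj_polar, conj_polar]
  exact polar_swap_left (fun α β γ δ => conj (s β α δ γ)) b a d c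

theorem quartic_smul (w : ℂ) (z : Fin n → ℂ) : quartic (w • s) z = w * quartic s z := by
  simp only [quartic, Finset.mul_sum, mul_assoc, Pi.smul_apply, smul_eq_mul]

/-- Symmetrization in the holomorphic and in the antiholomorphic indices. -/
def symmetrize : Fin n → Fin n → Fin n → Fin n → ℂ :=
  (1 / 4 : ℂ) • (s + (fun α β γ δ => s γ β α δ) + (fun α β γ δ => s α δ γ β)
    + fun α β γ δ => s γ δ α β)

theorem symmetrize_apply (α β γ δ : Fin n) :
    symmetrize s α β γ δ = 1 / 4 * (s α β γ δ + s γ β α δ + s α δ γ β + s γ δ α β) := rfl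

theorem quartic_symmetrize (z : Fin n → ℂ) : quartic (symmetrize s) z = quartic s z := by
  have hleft (s : Fin n → Fin n → Fin n → Fin n → ℂ) :
      quartic (fun α β γ δ => s γ β α δ) z = quartic s z := polar_swap_left s z z z z
  have hright : quartic (fun α β γ δ => s α δ γ β) z = quartic s z := polar_swap_right s z z z z
  rw [symmetrize, quartic_smul, quartic_add, quartic_add, quartic_add, hleft s, hright,
    hleft fun α β γ δ => s α δ γ β, hright]
  ring

end Polarization

section TraceDecomposition

variable {n : ℕ}

/-- The Hermitian form `∑ H_{αβ̄} z_α z̄_β`. -/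
def hermForm (H : Fin n → Fin n → ℂ) (z : Fin n → ℂ) : ℂ := ∑ α, ∑ β, H α β * (z α * conj (z β))

theorem normSqL_mul_hermForm (ℓ : ℕ) (H : Fin n → Fin n → ℂ) (z : Fin n → ℂ) :
    normSqL ℓ z * hermForm H z = quartic (fun α β γ δ => gInv ℓ α β * H γ δ) z := by
  rw [normSqL, hermForm, quartic, Finset.sum_mul]
  refine Finset.sum_congr rfl fun α _ => ?_
  refine Eq.trans ?_ (Finset.sum_eq_single α (fun β _ hβ => ?_) (by simp)).symm
  swap
  · simp [gInv, hβ.symm]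
  simp only [gInv, if_pos, Finset.mul_sum]
  refine Finset.sum_congr rfl fun γ _ => Finset.sum_congr rfl fun δ _ => ?_
  ring

theorem conj_gInv (ℓ : ℕ) (α β : Fin n) : conj (gInv ℓ α β) = gInv ℓ β α := by
  unfold gInv
  rcases eq_or_ne α β with rfl | h
  · rw [if_pos rfl, conj_sgn]
  · rw [if_neg h, if_neg h.symm, map_zero]

theorem sgn_mul_gInv (ℓ : ℕ) (α β : Fin n) : sgn ℓ α * gInv ℓ α β = if α = β then 1 else 0 := by
  unfold gInv
  split_ifs
  · exact sgn_mul_self ℓ α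
  · exact mul_zero _

theorem gInv_mul_sgn (ℓ : ℕ) (α β : Fin n) : gInv ℓ α β * sgn ℓ β = if α = β then 1 else 0 := by
  unfold gInv
  split_ifs with h
  · rw [h, sgn_mul_self]
  · exact zero_mul _

/-- The trace of `s` in the first pair of indices with respect to the model Levi form. -/
def metricTrace (ℓ : ℕ) (s : Fin n → Fin n → Fin n → Fin n → ℂ) (γ δ : Fin n) : ℂ :=
  ∑ α, sgn ℓ α * s α α γ δ

theorem sum_mul_gInv_eq_metricTrace (ℓ : ℕ) (s : Fin n → Fin n → Fin n → Fin n → ℂ)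
    (γ δ : Fin n) : ∑ α, ∑ β, s α β γ δ * gInv ℓ β α = metricTrace ℓ s γ δ := by
  refine Finset.sum_congr rfl fun α _ => ?_
  rw [Finset.sum_eq_single α (fun β _ hβ => by simp [gInv, hβ]) (by simp), gInv, if_pos rfl,
    mul_comm]

theorem conj_symmetrize {s : Fin n → Fin n → Fin n → Fin n → ℂ}
    (hs : ∀ α β γ δ, conj (s α β γ δ) = s β α δ γ) (α β γ δ : Fin n) :
    conj (symmetrize s α β γ δ) = symmetrize s β α δ γ := by
  simp only [symmetrize_apply, map_mul, map_add, map_div₀, map_one, map_ofNat, hs]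
  ring

theorem conj_metricTrace {ℓ : ℕ} {s : Fin n → Fin n → Fin n → Fin n → ℂ}
    (hs : ∀ α β γ δ, conj (s α β γ δ) = s β α δ γ) (γ δ : Fin n) :
    conj (metricTrace ℓ s γ δ) = metricTrace ℓ s δ γ := by
  simp only [metricTrace, map_sum, map_mul, hs, conj_sgn]

theorem metricTrace_symmetrize_gInv (ℓ : ℕ) (H : Fin n → Fin n → ℂ) (γ δ : Fin n) :
    metricTrace ℓ (symmetrize fun α β γ δ => gInv ℓ α β * H γ δ) γ δ
      = 1 / 4 * ((n + 2) * H γ δ + gInv ℓ γ δ * ∑ α, sgn ℓ α * H α α) := by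
  have hterm (α : Fin n) : sgn ℓ α * symmetrize (fun α β γ δ => gInv ℓ α β * H γ δ) α α γ δ =
      1 / 4 * (H γ δ + (if γ = α then 1 else 0) * H α δ + (if α = δ then 1 else 0) * H γ α
        + gInv ℓ γ δ * (sgn ℓ α * H α α)) := by
    have htr : sgn ℓ α * gInv ℓ α α = 1 := by rw [sgn_mul_gInv, if_pos rfl]
    rw [symmetrize_apply, ← gInv_mul_sgn ℓ γ α, ← sgn_mul_gInv ℓ α δ]
    linear_combination 1 / 4 * H γ δ * htr
  simp only [metricTrace, hterm, ← Finset.mul_sum, Finset.sum_add_distrib, ite_mul, one_mul,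
    zero_mul, Finset.sum_ite_eq, Finset.sum_ite_eq', Finset.mem_univ, if_true, Finset.sum_const,
    Finset.card_univ, Fintype.card_fin, nsmul_eq_mul]
  ring

theorem exists_metricTrace_symmetrize_gInv_eq (ℓ : ℕ) {t : Fin n → Fin n → ℂ}
    (ht : ∀ γ δ, conj (t γ δ) = t δ γ) : ∃ H : Fin n → Fin n → ℂ,
      (∀ γ δ, conj (H γ δ) = H δ γ) ∧
      ∀ γ δ, metricTrace ℓ (symmetrize fun α β γ δ => gInv ℓ α β * H γ δ) γ δ = t γ δ := by
  have hn : (n : ℂ) + 2 ≠ 0 := by exact_mod_cast (n + 1).succ_ne_zero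
  have hn' : (n : ℂ) + 1 ≠ 0 := by exact_mod_cast n.succ_ne_zero
  set τ : ℂ := ∑ α, sgn ℓ α * t α α with hτ
  have hτ_conj : conj τ = τ := by simp only [hτ, map_sum, map_mul, ht, conj_sgn]
  let H γ δ : ℂ := 4 / (n + 2) * (t γ δ - gInv ℓ γ δ * τ / (2 * (n + 1)))
  have hH (α : Fin n) : sgn ℓ α * H α α =
      4 / (n + 2) * (sgn ℓ α * t α α - τ / (2 * (n + 1))) := by
    have htr : sgn ℓ α * gInv ℓ α α = 1 := by rw [sgn_mul_gInv, if_pos rfl]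
    linear_combination -(4 / (n + 2) * (τ / (2 * (n + 1)))) * htr
  have hH_trace : ∑ α, sgn ℓ α * H α α = 2 * τ / (n + 1) := by
    simp only [hH, ← Finset.mul_sum, Finset.sum_sub_distrib, ← hτ, Finset.sum_const,
      Finset.card_univ, Fintype.card_fin, nsmul_eq_mul]
    field_simp
    ring
  refine ⟨H, fun γ δ => ?_, fun γ δ => ?_⟩
  · simp only [H, map_mul, map_sub, map_div₀, ht, hτ_conj, conj_gInv, map_add, map_natCast,
      map_ofNat, map_one]
  · rw [metricTrace_symmetrize_gInv, hH_trace]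
    simp only [H]
    field_simp
    ring

theorem isChernMoserTensor_symmetrize {ℓ : ℕ} {s : Fin n → Fin n → Fin n → Fin n → ℂ}
    (hs : ∀ α β γ δ, conj (s α β γ δ) = s β α δ γ)
    (htr : ∀ γ δ, metricTrace ℓ (symmetrize s) γ δ = 0) :
    IsChernMoserTensor ℓ (symmetrize s) where
  symm_left α β γ δ := by simp only [symmetrize_apply]; ring
  symm_pair α β γ δ := by simp only [symmetrize_apply]; ring
  conj_eq := conj_symmetrize hs
  trace_free γ δ := by rw [sum_mul_gInv_eq_metricTrace, htr]

theorem exists_trace_decomposition (ℓ : ℕ) (s₀ : Fin n → Fin n → Fin n → Fin n → ℂ) :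
    ∃ (s : Fin n → Fin n → Fin n → Fin n → ℂ) (H : Fin n → Fin n → ℂ),
      IsChernMoserTensor ℓ s ∧ (∀ α β, conj (H α β) = H β α) ∧
      ∀ z, (quartic s₀ z).re = normSqRe ℓ z * (hermForm H z).re - 1 / 4 * (quartic s z).re := by
  let σ α β γ δ : ℂ := 1 / 2 * (s₀ α β γ δ + conj (s₀ β α δ γ))
  have hσ : ∀ α β γ δ, conj (σ α β γ δ) = σ β α δ γ := fun α β γ δ => by
    simp only [σ, map_mul, map_add, map_div₀, map_one, map_ofNat, Complex.conj_conj, add_comm]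
  have hσ_quartic (z) : quartic σ z = (quartic s₀ z).re := by
    rw [Complex.re_eq_add_conj, quartic_eq_polar s₀, conj_polar, ← quartic_eq_polar,
      ← quartic_eq_polar, ← quartic_add, div_eq_inv_mul, ← one_div, ← quartic_smul]
    rfl
  obtain ⟨H, hH, htr⟩ := exists_metricTrace_symmetrize_gInv_eq ℓ
    (conj_metricTrace (ℓ := ℓ) (conj_symmetrize hσ))
  let P (α β γ δ : Fin n) : ℂ := gInv ℓ α β * H γ δ
  refine ⟨symmetrize ((-4 : ℂ) • (σ + (-1 : ℂ) • P)), H,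
    isChernMoserTensor_symmetrize (fun α β γ δ => ?_) (fun γ δ => ?_), hH, fun z => ?_⟩
  · simp only [Pi.smul_apply, Pi.add_apply, smul_eq_mul, map_mul, map_add, map_neg, map_ofNat,
      map_one, hσ, P, conj_gInv, hH]
  · have hlin : metricTrace ℓ (symmetrize ((-4 : ℂ) • (σ + (-1 : ℂ) • P))) γ δ = -4 *
        (metricTrace ℓ (symmetrize σ) γ δ - metricTrace ℓ (symmetrize P) γ δ) := by
      simp only [metricTrace, ← Finset.sum_sub_distrib, Finset.mul_sum, symmetrize_apply,
        Pi.smul_apply, Pi.add_apply, smul_eq_mul]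
      exact Finset.sum_congr rfl fun α _ => by ring
    rw [hlin, htr, sub_self, mul_zero]
  · rw [quartic_symmetrize, quartic_smul, quartic_add, quartic_smul, hσ_quartic,
      ← normSqL_mul_hermForm, ← normSqL_eq_re, ← Complex.ofReal_ofNat 4, ← Complex.ofReal_neg,
      ← Complex.ofReal_one, ← Complex.ofReal_neg, Complex.re_ofReal_mul, Complex.add_re,
      Complex.re_ofReal_mul, Complex.re_ofReal_mul, Complex.ofReal_re, normSqRe]
    ring

end TraceDecomposition

section Laplacian

variable {n : ℕ}

theorem fderiv_polar {V : Type*} [NormedAddCommGroup V] [NormedSpace ℝ V]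
    (s : Fin n → Fin n → Fin n → Fin n → ℂ) {a b c d : V → Fin n → ℂ}
    {a' b' c' d' : V →L[ℝ] Fin n → ℂ} {x : V} (ha : HasFDerivAt a a' x)
    (hb : HasFDerivAt b b' x) (hc : HasFDerivAt c c' x) (hd : HasFDerivAt d d' x) (v : V) :
    fderiv ℝ (fun y => polar s (a y) (b y) (c y) (d y)) x v =
      polar s (a' v) (b x) (c x) (d x) + polar s (a x) (b' v) (c x) (d x)
      + polar s (a x) (b x) (c' v) (d x) + polar s (a x) (b x) (c x) (d' v) := by
  have hconj {f : V → Fin n → ℂ} {f'} (hf : HasFDerivAt f f' x) (j : Fin n) :=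
    Complex.conjCLE.toContinuousLinearMap.hasFDerivAt.comp x (hasFDerivAt_pi'.1 hf j)
  have h := HasFDerivAt.fun_sum (u := Finset.univ) fun α _ =>
    HasFDerivAt.fun_sum (u := Finset.univ) fun β _ =>
    HasFDerivAt.fun_sum (u := Finset.univ) fun γ _ =>
    HasFDerivAt.fun_sum (u := Finset.univ) fun δ _ =>
    ((((hasFDerivAt_pi'.1 ha α).mul (hconj hb β)).mul (hasFDerivAt_pi'.1 hc γ)).mul
      (hconj hd δ)).const_mul (s α β γ δ)
  refine (congrArg (fun L : V →L[ℝ] ℂ => L v) h.fderiv).trans ?_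
  simp only [polar, ← Finset.sum_add_distrib, sum_apply]
  refine Finset.sum_congr rfl fun α _ => Finset.sum_congr rfl fun β _ =>
    Finset.sum_congr rfl fun γ _ => Finset.sum_congr rfl fun δ _ => ?_
  simp
  ring

theorem del_const_mul (w : ℂ) (f : (Fin n → ℂ) → ℂ) (x v : Fin n → ℂ) :
    del (fun y => w * f y) x v = w * del f x v := by
  have hfderiv : fderiv ℝ (fun y => w * f y) x = w • fderiv ℝ f x :=
    congrFun (fderiv_const_smul_field w) x
  simp only [del, hfderiv, smul_apply, smul_eq_mul]
  ring

theorem delBar_quartic {s : Fin n → Fin n → Fin n → Fin n → ℂ}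
    (hs : ∀ α β γ δ, s α β γ δ = s α δ γ β) (x v : Fin n → ℂ) :
    delBar (quartic s) x v = 2 * polar s x v x x := by
  have hswap : polar s x x x v = polar s x v x x := by
    conv_lhs => rw [funext fun α => funext fun β => funext fun γ => funext fun δ => hs α β γ δ]
    exact polar_swap_right s x x x v
  have hid := hasFDerivAt_id (𝕜 := ℝ) x
  have hfderiv (v) : fderiv ℝ (quartic s) x v = polar s v x x x + polar s x v x x
      + polar s x x v x + polar s x x x v := fderiv_polar s hid hid hid hid v
  have hI₁ := polar_smul s v x x x Complex.I 1 1 1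
  have hI₂ := polar_smul s x v x x 1 Complex.I 1 1
  have hI₃ := polar_smul s x x v x 1 1 Complex.I 1
  have hI₄ := polar_smul s x x x v 1 1 1 Complex.I
  simp only [one_smul, map_one, mul_one, one_mul, Complex.conj_I] at hI₁ hI₂ hI₃ hI₄
  rw [delBar, hfderiv, hfderiv, hI₁, hI₂, hI₃, hI₄, hswap]
  linear_combination 1 / 2 * (polar s v x x x + polar s x x v x - 2 * polar s x v x x)
    * Complex.I_mul_I

theorem del_polar {s : Fin n → Fin n → Fin n → Fin n → ℂ}
    (hs : ∀ α β γ δ, s α β γ δ = s γ β α δ) (x v : Fin n → ℂ) :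
    del (fun y => polar s y v y y) x v = 2 * polar s v v x x := by
  have hswap : polar s x v v x = polar s v v x x := by
    conv_lhs => rw [funext fun α => funext fun β => funext fun γ => funext fun δ => hs α β γ δ]
    exact polar_swap_left s x v v x
  have hid := hasFDerivAt_id (𝕜 := ℝ) x
  have hzero : polar s x 0 x x = 0 := by simp [polar]
  have hfderiv (t) : fderiv ℝ (fun y => polar s y v y y) x t = polar s t v x x
      + polar s x v t x + polar s x v x t := by
    refine (fderiv_polar s hid (hasFDerivAt_const v x) hid hid t).trans ?_
    rw [zero_apply, id, hzero, add_zero]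
    rfl
  have hI₁ := polar_smul s v v x x Complex.I 1 1 1
  have hI₃ := polar_smul s x v v x 1 1 Complex.I 1
  have hI₄ := polar_smul s x v x v 1 1 1 Complex.I
  simp only [one_smul, map_one, mul_one, one_mul, Complex.conj_I] at hI₁ hI₃ hI₄
  rw [del, hfderiv, hfderiv, hI₁, hI₃, hI₄, hswap]
  linear_combination 1 / 2 * (polar s x v x v - 2 * polar s v v x x) * Complex.I_mul_I

theorem laplacianL_quartic {ℓ : ℕ} {s : Fin n → Fin n → Fin n → Fin n → ℂ}
    (hs : IsChernMoserTensor ℓ s) (z : Fin n → ℂ) : laplacianL ℓ (quartic s) z = 0 := by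
  have hs_right (α β γ δ) : s α β γ δ = s α δ γ β := hs.symm_pair γ β α δ
  have hcoord (j : Fin n) : polar s (Pi.single j 1) (Pi.single j 1) z z =
      ∑ γ, ∑ δ, s j j γ δ * (z γ * conj (z δ)) := by
    simp [polar, Pi.single_apply]
  calc
    laplacianL ℓ (quartic s) z
      = ∑ j, sgn ℓ j * (4 * ∑ γ, ∑ δ, s j j γ δ * (z γ * conj (z δ))) := by
        refine Finset.sum_congr rfl fun j _ => ?_
        simp only [delBar_quartic hs_right]
        rw [del_const_mul, del_polar hs.symm_left, hcoord]
        ring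
    _ = 4 * ∑ γ, ∑ δ, metricTrace ℓ s γ δ * (z γ * conj (z δ)) := by
        simp only [metricTrace, Finset.mul_sum, Finset.sum_mul]
        rw [Finset.sum_comm]
        refine Finset.sum_congr rfl fun γ _ => ?_
        rw [Finset.sum_comm]
        refine Finset.sum_congr rfl fun δ _ => Finset.sum_congr rfl fun j _ => ?_
        ring
    _ = 0 := by
        simp only [← sum_mul_gInv_eq_metricTrace, hs.trace_free, zero_mul, Finset.sum_const_zero,
          mul_zero]

end Laplacian

/-! ### Normalization of the graph function -/

section Skew

variable {n : ℕ} {ℓ : ℕ}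

theorem hermRe_smul (ℓ : ℕ) (r : ℝ) (f z : Fin n → ℂ) :
    hermRe ℓ ((r : ℂ) • f) z = r * hermRe ℓ f z := by
  rw [hermRe, hermRe, ← Complex.re_ofReal_mul, Finset.mul_sum]
  congr 1
  refine Finset.sum_congr rfl fun j _ => ?_
  rw [Pi.smul_apply, smul_eq_mul]
  ring

theorem hermRe_I_smul_I_smul (ℓ : ℕ) (f z : Fin n → ℂ) :
    hermRe ℓ (Complex.I • f) (Complex.I • z) = hermRe ℓ f z := by
  refine congrArg Complex.re (Finset.sum_congr rfl fun j _ => ?_)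
  rw [Pi.smul_apply, Pi.smul_apply, smul_eq_mul, smul_eq_mul, map_mul, Complex.conj_I]
  linear_combination -sgn ℓ j * f j * conj (z j) * Complex.I_mul_I

theorem hermRe_smul_of_skew {B : (Fin n → ℂ) →L[ℂ] Fin n → ℂ}
    (hB : ∀ z z', hermRe ℓ (B z) z' = -hermRe ℓ z (B z')) (w : ℂ) (z : Fin n → ℂ) :
    hermRe ℓ (w • B z) z = w.im * hermRe ℓ (Complex.I • B z) z := by
  have hzero : hermRe ℓ (B z) z = 0 := by
    have hself := hB z z
    rw [hermRe_comm ℓ z] at hself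
    linarith
  conv_lhs => rw [← Complex.re_add_im w, add_smul, mul_smul]
  rw [hermRe_add, hermRe_smul, hermRe_smul, hzero, mul_zero, zero_add]

theorem normSqRe_add_smul_add_of_skew {B : (Fin n → ℂ) →L[ℂ] Fin n → ℂ}
    (hB : ∀ z z', hermRe ℓ (B z) z' = -hermRe ℓ z (B z')) (w : ℂ) (z k : Fin n → ℂ) :
    normSqRe ℓ (z + (w • B z + k)) =
      normSqRe ℓ z + 2 * w.im * hermRe ℓ (Complex.I • B z) z + 2 * hermRe ℓ k z +
        Complex.normSq w * normSqRe ℓ (B z) + 2 * hermRe ℓ k (w • B z) + normSqRe ℓ k := by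
  rw [normSqRe_add, hermRe_add, hermRe_smul_of_skew hB, normSqRe_add, normSqRe_smul]
  ring

theorem exists_skew_hermForm_re_eq (ℓ : ℕ) {H : Fin n → Fin n → ℂ}
    (hH : ∀ α β, conj (H α β) = H β α) : ∃ B : (Fin n → ℂ) →L[ℂ] Fin n → ℂ,
      (∀ z z', hermRe ℓ (B z) z' = -hermRe ℓ z (B z')) ∧
      ∀ z, (hermForm H z).re = -2 * hermRe ℓ (Complex.I • B z) z := by
  let B : (Fin n → ℂ) →L[ℂ] Fin n → ℂ :=
    (Matrix.of fun k α => Complex.I / 2 * sgn ℓ k * H α k).mulVecLin.toContinuousLinearMap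
  have hB (z k) : B z k = Complex.I / 2 * sgn ℓ k * ∑ α, H α k * z α := by
    simp only [Finset.mul_sum, ← mul_assoc]
    rfl
  have hpair (z z' : Fin n → ℂ) : ∑ k, sgn ℓ k * (B z k * conj (z' k)) =
      Complex.I / 2 * ∑ α, ∑ k, H α k * (z α * conj (z' k)) := by
    rw [Finset.sum_comm, Finset.mul_sum]
    refine Finset.sum_congr rfl fun k _ => ?_
    have hassoc : ∑ α, H α k * (z α * conj (z' k)) = (∑ α, H α k * z α) * conj (z' k) := by
      simp only [Finset.sum_mul, mul_assoc]
    rw [hB, hassoc]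
    linear_combination (Complex.I / 2 * (∑ α, H α k * z α) * conj (z' k)) * sgn_mul_self ℓ k
  refine ⟨B, fun z z' => ?_, fun z => ?_⟩
  · rw [hermRe_comm ℓ z, hermRe, hermRe, hpair, hpair, ← Complex.conj_re, ← Complex.neg_re]
    congr 1
    rw [Finset.sum_comm]
    simp only [map_mul, map_sum, map_div₀, map_ofNat, Complex.conj_I, Complex.conj_conj, hH,
      mul_comm (conj (z _))]
    ring
  · rw [hermRe, hermForm, ← Complex.re_ofReal_mul]
    have hI : ∑ k, sgn ℓ k * ((Complex.I • B z) k * conj (z k)) =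
        Complex.I * ∑ k, sgn ℓ k * (B z k * conj (z k)) := by
      rw [Finset.mul_sum]
      refine Finset.sum_congr rfl fun k _ => ?_
      rw [Pi.smul_apply, smul_eq_mul]
      ring
    rw [hI, hpair]
    congr 1
    push_cast
    linear_combination (∑ α, ∑ k, H α k * (z α * conj (z k))) * Complex.I_mul_I

theorem contDiff_quartic (s : Fin n → Fin n → Fin n → Fin n → ℂ) :
    ContDiff ℝ ∞ (quartic s) := by
  have hconj : ∀ j, ContDiff ℝ ∞ fun z : Fin n → ℂ => conj (z j) := fun j =>
    Complex.conjCLE.contDiff.comp (by fun_prop)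
  unfold quartic
  fun_prop

theorem vanishesToOrder_quartic_re (s : Fin n → Fin n → Fin n → Fin n → ℂ) :
    VanishesToOrder 4 fun y : CnR n => (quartic s y.1).re := by
  have hcont : Continuous fun y : CnR n => (quartic s y.1).re :=
    Complex.continuous_re.comp ((contDiff_quartic s).continuous.comp continuous_fst)
  refine .of_homogeneous hcont.continuousAt fun t y => ?_
  have hsmul := polar_smul s y.1 y.1 y.1 y.1 t t t t
  rw [← quartic_eq_polar, ← quartic_eq_polar, Complex.conj_ofReal] at hsmul
  rw [Prod.smul_fst, ← Complex.coe_smul t y.1, hsmul, smul_eq_mul, ← Complex.re_ofReal_mul]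
  congr 2
  push_cast
  ring

end Skew

section Normalization

variable {n : ℕ} {M : Set (Cn1 n)} {p : Cn1 n} {T : Cn1 n ≃L[ℂ] Cn1 n} {Γ : Cn1 n → Cn1 n}
  {φ : CnR n → ℝ} {ℓ k : ℕ} {N : CnR n → ℝ}

theorem IsHolHomogeneous.vanishesToOrder_im_sub {g : Cn1 n → ℂ} (hg : IsHolHomogeneous (k + 1) g)
    (hN : VanishesToOrder 2 N) :
    VanishesToOrder (k + 2) fun y => (g (pointOver y (N y))).im - (g (pointOver y 0)).im := by
  refine IsBigO.trans (IsBigO.of_bound 1 (Eventually.of_forall fun y => ?_))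
    (hg.vanishesToOrder_sub_pointOver hN)
  rw [one_mul, ← Complex.sub_im]
  exact Complex.abs_im_le_norm _

theorem IsHolHomogeneous.vanishesToOrder_hermRe_sub {f : Cn1 n → Fin n → ℂ}
    (hf : IsHolHomogeneous (k + 1) f) (hN : VanishesToOrder 2 N) :
    VanishesToOrder (k + 3) fun y =>
      hermRe ℓ (f (pointOver y (N y))) y.1 - hermRe ℓ (f (pointOver y 0)) y.1 := by
  refine ((hf.vanishesToOrder_sub_pointOver hN).hermRe vanishesToOrder_fst
    (ℓ := ℓ)).congr_left fun y => ?_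
  rw [eq_sub_iff_add_eq, ← hermRe_add, sub_add_cancel]

theorem IsGraphChart.exists_leading_term (h : IsGraphChart M p T Γ φ) {d : ℕ}
    (hφ : VanishesToOrder d fun y => φ y - normSqRe ℓ y.1) :
    ∃ m : ContinuousMultilinearMap ℝ (fun _ : Fin d => CnR n) ℝ,
      VanishesToOrder (d + 1) fun y => φ y - (normSqRe ℓ y.1 + m fun _ => y) := by
  have hsmooth : ContDiffAt ℝ (d + 1) (fun y => φ y - normSqRe ℓ y.1) 0 :=
    (h.smooth.self_of_nhds.sub ((contDiff_normSqRe ℓ).comp contDiff_fst).contDiffAt).of_le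
      (WithTop.coe_le_coe.2 le_top)
  refine ⟨(d.factorial : ℝ)⁻¹ • iteratedFDeriv ℝ d (fun y => φ y - normSqRe ℓ y.1) 0,
    (vanishesToOrder_sub_leading_term hsmooth hφ).congr_left fun y => ?_⟩
  simp only [smul_apply]
  ring

theorem hermRe_eq_zero_of_splitting {m : CnR n → ℝ}
    (hm : ∀ z, m (z, 0) + m (Complex.I • z, 0) = 0) {g : Cn1 n → ℂ} {f : Cn1 n → Fin n → ℂ}
    (hg : IsHolHomogeneous 2 g) (hf : IsHolHomogeneous 1 f) (hfst : ∀ x, f x = f (x.1, 0))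
    (hsplit : ∀ y, m y = (g (pointOver y 0)).im - 2 * hermRe ℓ (f (pointOver y 0)) y.1)
    (y : CnR n) : hermRe ℓ (f (pointOver y 0)) y.1 = 0 := by
  have hpt : pointOver ((Complex.I • y.1, 0) : CnR n) 0 = Complex.I • ((y.1, 0) : Cn1 n) := by
    rw [Prod.smul_mk, smul_zero]
    rfl
  have hg_neg : (g (Complex.I • (y.1, 0))).im = -(g (y.1, 0)).im := by
    rw [hg.map_smul, Complex.I_sq, neg_one_smul, Complex.neg_im]
  have hf_rot : hermRe ℓ (f (Complex.I • (y.1, 0))) (Complex.I • y.1) =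
      hermRe ℓ (f (y.1, 0)) y.1 := by
    rw [hf.map_smul, pow_one, hermRe_I_smul_I_smul]
  have hsum := hm y.1
  rw [hsplit, hsplit, hpt, hg_neg, hf_rot] at hsum
  rw [hfst]
  have hpt' : pointOver ((y.1, 0) : CnR n) 0 = (y.1, 0) := rfl
  rw [hpt'] at hsum
  change hermRe ℓ (f (y.1, 0)) y.1 = 0
  linarith

theorem IsGraphChart.exists_normalized_two (h : IsGraphChart M p T Γ φ)
    (m : ContinuousMultilinearMap ℝ (fun _ : Fin 2 => CnR n) ℝ)
    (hφ : VanishesToOrder 3 fun y => φ y - (normSqRe ℓ y.1 + m fun _ => y))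
    (hm : ∀ z, (m fun _ => (z, 0)) + (m fun _ => (Complex.I • z, 0)) = 0) :
    ∃ Γ' φ', IsGraphChart M p T Γ' φ' ∧ VanishesToOrder 3 fun y => φ' y - normSqRe ℓ y.1 := by
  obtain ⟨g, f, s, hg, hf, hs, hfst, hsplit⟩ :=
    hasSplitting_multilinear_diag ℓ (e := 1) (by norm_num) m.toMultilinearMap
  have hm_eq (y) : (m fun _ => y) =
      (g (pointOver y 0)).im - 2 * hermRe ℓ (f (pointOver y 0)) y.1 := by
    have := hsplit y
    rwa [hs one_le_two, quartic_zero, Complex.zero_re, add_zero, Complex.ofReal_re] at this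
  have hpair := hermRe_eq_zero_of_splitting hm hg hf (hfst rfl) hm_eq
  have hN : VanishesToOrder 2 fun y : CnR n => normSqRe ℓ y.1 := vanishesToOrder_normSqRe_fst ℓ
  refine h.normalize m hφ (f := 0) contDiff_const hg.contDiff (isBigO_zero _ _)
    hg.vanishesToOrder (hN.of_le one_le_two) ?_
  refine (hg.vanishesToOrder_im_sub hN).congr_left fun y => ?_
  rw [hm_eq, hpair, Pi.zero_apply, add_zero]
  ring

theorem IsGraphChart.exists_normalized_three (h : IsGraphChart M p T Γ φ)
    (hφ : VanishesToOrder 3 fun y => φ y - normSqRe ℓ y.1) :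
    ∃ Γ' φ', IsGraphChart M p T Γ' φ' ∧ VanishesToOrder 4 fun y => φ' y - normSqRe ℓ y.1 := by
  obtain ⟨m, hm⟩ := h.exists_leading_term hφ
  obtain ⟨g, f, s, hg, hf, hs, -, hsplit⟩ :=
    hasSplitting_multilinear_diag ℓ (e := 2) (by norm_num) m.toMultilinearMap
  have hm_eq (y) : (m fun _ => y) =
      (g (pointOver y 0)).im - 2 * hermRe ℓ (f (pointOver y 0)) y.1 := by
    have := hsplit y
    rwa [hs le_rfl, quartic_zero, Complex.zero_re, add_zero, Complex.ofReal_re] at this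
  have hN : VanishesToOrder 2 fun y : CnR n => normSqRe ℓ y.1 := vanishesToOrder_normSqRe_fst ℓ
  have hN₁ := hN.of_le one_le_two
  have hfN := vanishesToOrder_comp_pointOver hf.vanishesToOrder hN₁
  refine h.normalize m hm hf.contDiff hg.contDiff hf.vanishesToOrder
    (hg.vanishesToOrder.of_le (by norm_num)) hN₁ ?_
  refine (((hg.vanishesToOrder_im_sub hN).sub
    ((hf.vanishesToOrder_hermRe_sub hN (ℓ := ℓ)).const_mul_left 2)).sub
      (hfN.hermRe hfN (ℓ := ℓ))).congr_left fun y => ?_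
  rw [hm_eq, normSqRe_add, ← normSqRe_eq_hermRe]
  ring

theorem exists_skew_trace_decomposition (ℓ : ℕ) (s₀ : Fin n → Fin n → Fin n → Fin n → ℂ) :
    ∃ (s : Fin n → Fin n → Fin n → Fin n → ℂ) (B : (Fin n → ℂ) →L[ℂ] Fin n → ℂ),
      IsChernMoserTensor ℓ s ∧ (∀ z z', hermRe ℓ (B z) z' = -hermRe ℓ z (B z')) ∧
      ∀ z, (quartic s₀ z).re =
        -2 * normSqRe ℓ z * hermRe ℓ (Complex.I • B z) z - 1 / 4 * (quartic s z).re := by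
  obtain ⟨s, H, hs, hH, hdecomp⟩ := exists_trace_decomposition ℓ s₀
  obtain ⟨B, hB, hHB⟩ := exists_skew_hermForm_re_eq ℓ hH
  refine ⟨s, B, hs, hB, fun z => ?_⟩
  rw [hdecomp, hHB]
  ring

section Rescaling

variable {B : (Fin n → ℂ) →L[ℂ] Fin n → ℂ} {f : Cn1 n → Fin n → ℂ}

/-- The cubic part of the `z`-shift in degree four: `f` together with the quadratic term of
`exp (w B) z`. -/
def cubicShift (B : (Fin n → ℂ) →L[ℂ] Fin n → ℂ) (f : Cn1 n → Fin n → ℂ) (x : Cn1 n) : Fin n → ℂ :=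
  f x + ((1 / 2 : ℝ) : ℂ) • x.2 ^ 2 • B (B x.1)

theorem isHolHomogeneous_snd_smul (B : (Fin n → ℂ) →L[ℂ] Fin n → ℂ) :
    IsHolHomogeneous 2 fun x : Cn1 n => x.2 • B x.1 :=
  (isHolHomogeneous_clm (.snd ℂ (Fin n → ℂ) ℂ)).smul
    (isHolHomogeneous_clm (B ∘L .fst ℂ (Fin n → ℂ) ℂ))

theorem isHolHomogeneous_cubicShift (B : (Fin n → ℂ) →L[ℂ] Fin n → ℂ)
    (hf : IsHolHomogeneous 3 f) : IsHolHomogeneous 3 (cubicShift B f) := by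
  have hw := isHolHomogeneous_clm (.snd ℂ (Fin n → ℂ) ℂ)
  have hquad := (hw.smul hw).smul (isHolHomogeneous_clm (B ∘L B ∘L .fst ℂ (Fin n → ℂ) ℂ))
  convert hf.add (hquad.const_smul ((1 / 2 : ℝ) : ℂ)) using 1
  funext x
  simp [cubicShift, sq]

theorem hermRe_cubicShift_pointOver_zero
    (hB : ∀ z z', hermRe ℓ (B z) z' = -hermRe ℓ z (B z')) (y : CnR n) :
    hermRe ℓ (cubicShift B f (pointOver y 0)) y.1 =
      hermRe ℓ (f (pointOver y 0)) y.1 - 1 / 2 * (y.2 ^ 2 * normSqRe ℓ (B y.1)) := by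
  have hw : (pointOver y 0).2 ^ 2 = ((y.2 ^ 2 : ℝ) : ℂ) := by
    rw [Complex.ofReal_pow]
    rfl
  have hz : (pointOver y 0).1 = y.1 := rfl
  rw [cubicShift, hw, hz, hermRe_add, hermRe_smul, hermRe_smul, hB, ← normSqRe_eq_hermRe]
  ring

theorem vanishesToOrder_rescaling_remainder (hf : IsHolHomogeneous 3 f)
    (hN : VanishesToOrder 2 N) (hN₄ : VanishesToOrder 4 fun y => N y - normSqRe ℓ y.1) :
    VanishesToOrder 5 fun y =>
      2 * (hermRe ℓ (f (pointOver y (N y))) y.1 - hermRe ℓ (f (pointOver y 0)) y.1) +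
      2 * ((N y - normSqRe ℓ y.1) * hermRe ℓ (Complex.I • B y.1) y.1) +
      N y * N y * normSqRe ℓ (B y.1) +
      2 * hermRe ℓ (f (pointOver y (N y))) ((pointOver y (N y)).2 • B y.1) +
      normSqRe ℓ (f (pointOver y (N y))) := by
  have hN₁ := hN.of_le one_le_two
  have hfN := vanishesToOrder_comp_pointOver hf.vanishesToOrder hN₁
  have hbN := vanishesToOrder_comp_pointOver (isHolHomogeneous_snd_smul B).vanishesToOrder hN₁
  have hBz : VanishesToOrder 1 fun y : CnR n => B y.1 :=
    (B.isBigO_comp _ _).trans vanishesToOrder_fst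
  have hIBz : VanishesToOrder 1 fun y : CnR n => Complex.I • B y.1 :=
    hBz.const_smul_left Complex.I
  have hlinear := (hf.vanishesToOrder_hermRe_sub hN (ℓ := ℓ)).const_mul_left 2
  have hmixed := (VanishesToOrder.mul hN₄
    (hIBz.hermRe vanishesToOrder_fst (ℓ := ℓ))).const_mul_left 2
  have hsquare := VanishesToOrder.mul (VanishesToOrder.mul hN hN) (hBz.hermRe hBz (ℓ := ℓ))
  have hcross := (hfN.hermRe hbN (ℓ := ℓ)).const_mul_left 2
  exact (((hlinear.add (VanishesToOrder.of_le hmixed (by norm_num))).add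
    (VanishesToOrder.of_le hsquare (by norm_num))).add hcross).add
      ((hfN.hermRe hfN (ℓ := ℓ)).of_le (by norm_num))

end Rescaling

theorem IsGraphChart.exists_normalized_four (h : IsGraphChart M p T Γ φ)
    (hφ : VanishesToOrder 4 fun y => φ y - normSqRe ℓ y.1) :
    ∃ s Γ' φ', IsChernMoserTensor ℓ s ∧ IsGraphChart M p T Γ' φ' ∧
      VanishesToOrder 5 fun y => φ' y - (normSqRe ℓ y.1 - 1 / 4 * (quartic s y.1).re) := by
  obtain ⟨m, hm⟩ := h.exists_leading_term hφ
  obtain ⟨g, f, s₀, hg, hf, -, -, hsplit⟩ :=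
    hasSplitting_multilinear_diag ℓ (e := 3) le_rfl m.toMultilinearMap
  obtain ⟨s, B, hs, hB, hs₀⟩ := exists_skew_trace_decomposition ℓ s₀
  have hm_eq (y) : (m fun _ => y) =
      (g (pointOver y 0)).im - 2 * hermRe ℓ (f (pointOver y 0)) y.1 + (quartic s₀ y.1).re := by
    have := hsplit y
    rwa [Complex.ofReal_re] at this
  let N : CnR n → ℝ := fun y => normSqRe ℓ y.1 - 1 / 4 * (quartic s y.1).re
  have hN₄ : VanishesToOrder 4 fun y => N y - normSqRe ℓ y.1 :=
    ((vanishesToOrder_quartic_re s).const_mul_left (-1 / 4)).congr_left fun y => by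
      simp only [N]
      ring
  have hN : VanishesToOrder 2 N :=
    ((vanishesToOrder_normSqRe_fst ℓ).add (hN₄.of_le (by norm_num))).congr_left fun y => by ring
  have hk := isHolHomogeneous_cubicShift B hf
  have hb := isHolHomogeneous_snd_smul B
  have hnormalize := h.normalize m hm (hb.contDiff.add hk.contDiff) hg.contDiff
    (hb.vanishesToOrder.add (hk.vanishesToOrder.of_le (by norm_num)))
    (hg.vanishesToOrder.of_le (by norm_num)) (hN.of_le one_le_two) <| by
      refine ((hg.vanishesToOrder_im_sub hN).sub
        (vanishesToOrder_rescaling_remainder hk hN hN₄ (B := B))).congr_left fun y => ?_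
      have hz : (pointOver y (N y)).1 = y.1 := rfl
      have hw : Complex.normSq (pointOver y (N y)).2 = y.2 ^ 2 + N y * N y := by
        rw [sq]
        rfl
      have hv : (pointOver y (N y)).2.im = N y := rfl
      rw [hm_eq, hs₀, hz, normSqRe_add_smul_add_of_skew hB, hw, hv,
        hermRe_cubicShift_pointOver_zero hB]
      simp only [N]
      ring
  obtain ⟨Γ', φ', hΓ', hφ'⟩ := hnormalize
  exact ⟨s, Γ', φ', hs, hΓ', hφ'⟩

end Normalization

section SecondOrder

variable {E F G : Type*} [NormedAddCommGroup E] [NormedSpace ℝ E] [NormedAddCommGroup F]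
  [NormedSpace ℝ F] [NormedAddCommGroup G] [NormedSpace ℝ G]

theorem vanishesToOrder_bilinear {D : Type*} [NormedAddCommGroup D] (L : E →L[ℝ] F →L[ℝ] G)
    {f : D → E} {g : D → F} {a b : ℕ} (hf : VanishesToOrder a f) (hg : VanishesToOrder b g) :
    VanishesToOrder (a + b) fun y => L (f y) (g y) :=
  L.isBoundedBilinearMap.isBigO_comp.trans (VanishesToOrder.mul hf.norm_left hg.norm_left)

theorem vanishesToOrder_sub_second_order {H : E → ℝ} (hH : ContDiffAt ℝ 3 H 0) :
    VanishesToOrder 3 fun x => H x - (H 0 + fderiv ℝ H 0 x + 1 / 2 * hess H 0 x x) := by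
  refine (vanishesToOrder_taylor_remainder (d := 2) hH).congr_left fun x => ?_
  rw [Finset.sum_range_succ, Finset.sum_range_succ, Finset.sum_range_one,
    iteratedFDeriv_two_apply]
  simp [hess]

theorem fderiv_comp_const_add (T : E ≃L[ℝ] F) (ρ : F → ℝ) (p : F) (x : E) :
    fderiv ℝ (fun x => ρ (p + T x)) x = fderiv ℝ ρ (p + T x) ∘L (T : E →L[ℝ] F) := by
  have := T.comp_right_fderiv (f := fun q => ρ (p + q)) (x := x)
  rwa [fderiv_comp_add_left] at this

theorem hess_comp_const_add (T : E ≃L[ℝ] F) {ρ : F → ℝ} {p : F} (hρ : ContDiffAt ℝ 2 ρ p)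
    (a b : E) : hess (fun x => ρ (p + T x)) 0 a b = hess ρ p (T a) (T b) := by
  have hp : p + T 0 = p := by rw [map_zero, add_zero]
  have hT : HasFDerivAt (fun x => p + T x) (T : E →L[ℝ] F) 0 := T.hasFDerivAt.const_add p
  have hcomp : HasFDerivAt (fun x => fderiv ℝ ρ (p + T x) (T b))
      ((hess ρ p).flip (T b) ∘L (T : E →L[ℝ] F)) 0 :=
    HasFDerivAt.comp (g := fun q => fderiv ℝ ρ q (T b)) 0
      (by simpa only [hp] using (hasStrictFDerivAt_fderiv_apply hρ (T b)).hasFDerivAt) hT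
  have hH : ContDiffAt ℝ 2 (fun x => ρ (p + T x)) 0 :=
    ContDiffAt.comp 0 (by rwa [hp]) (contDiffAt_const.add T.contDiff.contDiffAt)
  have hfderiv := (hasStrictFDerivAt_fderiv_apply hH b).hasFDerivAt
  simp only [fderiv_comp_const_add] at hfderiv
  exact DFunLike.congr_fun (hfderiv.unique hcomp) a

end SecondOrder

section QuadraticChart

variable {n ℓ : ℕ} {M : Set (Cn1 n)} {p : Cn1 n} {ρ : Cn1 n → ℝ} {T : Cn1 n ≃L[ℂ] Cn1 n}
  {θ : tangentSpaceAt M p →ₗ[ℝ] ℝ}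

theorem exists_graph_second_order {H : Cn1 n → ℝ} (hH : ∀ᶠ x in 𝓝 0, ContDiffAt ℝ ∞ H x)
    (h0 : H 0 = 0) (hd : ∀ x, fderiv ℝ H 0 x = x.2.im) :
    ∃ φ : CnR n → ℝ, (∀ᶠ y in 𝓝 0, ContDiffAt ℝ ∞ φ y) ∧ φ 0 = 0 ∧
      VanishesToOrder 3 (fun y =>
        φ y - -(1 / 2) * hess H 0 (pointOver y 0) (pointOver y 0)) ∧
      ∀ᶠ x in 𝓝 0, H x = 0 ↔ x.2.im = φ (x.1, x.2.re) := by
  let N : CnR n → ℝ := fun y => -(1 / 2) * hess H 0 (pointOver y 0) (pointOver y 0)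
  have hpt := vanishesToOrder_pointOver_zero (n := n)
  have hN : VanishesToOrder 2 N := (vanishesToOrder_bilinear _ hpt hpt).const_mul_left _
  have hptN := VanishesToOrder.pointOver (hN.of_le one_le_two)
  have hsub := vanishesToOrder_pointOver_sub hN
  refine exists_graph hH h0 hd (hN.tendsto_zero two_ne_zero) ?_
  have hH₃ : ContDiffAt ℝ 3 H 0 :=
    hH.self_of_nhds.of_le (WithTop.coe_le_coe.2 (le_top : (3 : ℕ∞) ≤ ⊤))
  have htaylor := vanishesToOrder_comp_pointOver (vanishesToOrder_sub_second_order hH₃)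
    (hN.of_le one_le_two)
  have hleft : VanishesToOrder 3 _ := vanishesToOrder_bilinear (hess H 0) hptN hsub
  have hright : VanishesToOrder 3 _ := vanishesToOrder_bilinear (hess H 0) hsub hpt
  refine (htaylor.add ((hleft.add hright).const_mul_left (1 / 2))).congr_left fun y => ?_
  have him : (pointOver y (N y)).2.im = -(1 / 2) * hess H 0 (pointOver y 0) (pointOver y 0) := rfl
  simp only [h0, hd, him, map_sub, sub_apply]
  ring

theorem IsAdaptedFrame.exists_affine_chart (hT : IsAdaptedFrame ℓ ρ θ T)
    (hρ : IsLocalDefining M p ρ) (hp : p ∈ M) :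
    ∃ φ, IsGraphChart M p T (fun x => p + T x) φ ∧ VanishesToOrder 3 fun y =>
      φ y - -(1 / 2) * hess ρ p (T (pointOver y 0)) (T (pointOver y 0)) := by
  let A : Cn1 n → Cn1 n := fun x => p + T x
  let TR : Cn1 n ≃L[ℝ] Cn1 n := T.restrictScalars ℝ
  have hA : ContDiff ℂ ∞ A := contDiff_const.add T.contDiff
  have hA0 : A 0 = p := by simp only [A, map_zero, add_zero]
  have hAt : Tendsto A (𝓝 0) (𝓝 p) := by
    simpa only [hA0] using hA.continuous.tendsto 0
  have hsmooth : ∀ᶠ x in 𝓝 0, ContDiffAt ℝ ∞ (ρ ∘ A) x :=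
    (hAt.eventually hρ.eventually_contDiffAt).mono fun x hx =>
      hx.comp x (hA.restrict_scalars ℝ).contDiffAt
  have hfderiv (x) : fderiv ℝ (ρ ∘ A) 0 x = x.2.im := by
    rw [← hT.fderiv_apply, ← hA0]
    exact DFunLike.congr_fun (fderiv_comp_const_add TR ρ p 0) x
  have hhess (a b) : hess (ρ ∘ A) 0 a b = hess ρ p (T a) (T b) :=
    hess_comp_const_add TR hρ.contDiffAt_two a b
  have hzero : (ρ ∘ A) 0 = 0 := by rw [Function.comp_apply, hA0, hρ.apply_eq_zero hp]
  obtain ⟨φ, hφ, h0, hO, hiff⟩ := exists_graph_second_order hsmooth hzero hfderiv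
  refine ⟨φ, ⟨hA, hA0, T.hasFDerivAt.const_add p, hφ, h0, ?_⟩, ?_⟩
  · filter_upwards [hAt.eventually hρ.eventually_mem_iff, hiff] with x hx₁ hx₂
    exact hx₁.trans hx₂
  · simpa only [hhess] using hO

theorem normSqRe_fst_smul (t : ℝ) (y : CnR n) : normSqRe ℓ (t • y).1 = t ^ 2 * normSqRe ℓ y.1 := by
  rw [Prod.smul_fst, ← Complex.coe_smul, normSqRe_smul, Complex.normSq_ofReal, sq]

theorem pointOver_smul_zero (t : ℝ) (y : CnR n) : pointOver (t • y) 0 = t • pointOver y 0 :=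
  Prod.ext rfl (Complex.ext (by simp [pointOver]) (by simp [pointOver]))

theorem IsAdaptedFrame.exists_normalized_two (hT : IsAdaptedFrame ℓ ρ θ T)
    (hρ : IsLocalDefining M p ρ) (hp : p ∈ M) :
    ∃ Γ φ, IsGraphChart M p T Γ φ ∧ VanishesToOrder 3 fun y => φ y - normSqRe ℓ y.1 := by
  obtain ⟨φ, hφ, hO⟩ := hT.exists_affine_chart hρ hp
  let Q : CnR n → ℝ := fun y => -(1 / 2) * hess ρ p (T (pointOver y 0)) (T (pointOver y 0))
  have hTpt : VanishesToOrder 1 fun y : CnR n => T (pointOver y 0) :=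
    ((T : Cn1 n →L[ℂ] Cn1 n).isBigO_comp _ _).trans vanishesToOrder_pointOver_zero
  have hQ : VanishesToOrder 2 Q :=
    (vanishesToOrder_bilinear (hess ρ p) hTpt hTpt).const_mul_left _
  have hTsmul (t : ℝ) (x : Cn1 n) : T (t • x) = t • T x := (T.restrictScalars ℝ).map_smul t x
  have hφ₂ : VanishesToOrder 2 fun y => φ y - normSqRe ℓ y.1 :=
    (((VanishesToOrder.of_le hO (by norm_num)).add hQ).sub
      (vanishesToOrder_normSqRe_fst ℓ)).congr_left fun y => by ring
  obtain ⟨m, hm⟩ := hφ.exists_leading_term hφ₂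
  have hm_eq (y) : (m fun _ => y) = Q y - normSqRe ℓ y.1 := by
    refine sub_eq_zero.1 (VanishesToOrder.eq_zero_of_homogeneous (k := 2)
      (f := fun y => (m fun _ => y) - (Q y - normSqRe ℓ y.1))
      ((hO.sub hm).congr_left fun y => by ring) (fun t y => ?_) y)
    have hmsmul : (m fun _ => t • y) = t ^ 2 • m fun _ => y := by
      simpa using m.map_smul_univ (fun _ => t) (fun _ => y)
    simp only [hmsmul, Q, pointOver_smul_zero, hTsmul, map_smul, smul_apply, smul_eq_mul,
      normSqRe_fst_smul]
    ring
  refine hφ.exists_normalized_two m hm fun z => ?_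
  have hpt (z : Fin n → ℂ) : pointOver ((z, 0) : CnR n) 0 = (z, 0) := rfl
  have hnormSq_I : normSqRe ℓ (Complex.I • z) = normSqRe ℓ z := by
    rw [normSqRe_smul, Complex.normSq_I, one_mul]
  have hhess := hT.hess_apply z
  rw [← normSqRe] at hhess
  rw [hm_eq, hm_eq]
  simp only [Q, hpt, hnormSq_I]
  linarith

theorem IsAdaptedFrame.exists_normal_chart (hT : IsAdaptedFrame ℓ ρ θ T)
    (hρ : IsLocalDefining M p ρ) (hp : p ∈ M) :
    ∃ s Γ φ, IsChernMoserTensor ℓ s ∧ IsGraphChart M p T Γ φ ∧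
      VanishesToOrder 5 fun y => φ y - (normSqRe ℓ y.1 - 1 / 4 * (quartic s y.1).re) := by
  obtain ⟨Γ₂, φ₂, hΓ₂, hφ₂⟩ := hT.exists_normalized_two hρ hp
  obtain ⟨Γ₃, φ₃, hΓ₃, hφ₃⟩ := hΓ₂.exists_normalized_three hφ₂
  exact hΓ₃.exists_normalized_four hφ₃

end QuadraticChart

/-! ### The normal form -/

section LittleO

variable {n : ℕ}

theorem VanishesToOrder.isLittleO {E F : Type*} [NormedAddCommGroup E] [NormedAddCommGroup F]
    {f : E → F} {k m : ℕ} (hf : VanishesToOrder m f) (hkm : k < m) :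
    f =o[𝓝 0] fun x => ‖x‖ ^ k :=
  hf.trans_isLittleO (isLittleO_norm_pow_norm_pow hkm)

theorem norm_weighted_dilation_le {t : ℝ} (ht : |t| ≤ 1) (y : CnR n) :
    ‖((t • y.1, t ^ 2 * y.2) : CnR n)‖ ≤ |t| * ‖y‖ := by
  rw [Prod.norm_mk, norm_smul, norm_mul, norm_pow, Real.norm_eq_abs]
  refine max_le (mul_le_mul_of_nonneg_left (norm_fst_le y) (abs_nonneg t)) ?_
  exact mul_le_mul (pow_le_of_le_one (abs_nonneg t) ht two_ne_zero) (norm_snd_le y)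
    (norm_nonneg _) (abs_nonneg t)

theorem VanishesToOrder.exists_eventually_weighted_le {R : CnR n → ℝ} {k : ℕ}
    (hR : VanishesToOrder k R) {K : Set (CnR n)} (hK : Bornology.IsBounded K) :
    ∃ C, ∀ᶠ t : ℝ in 𝓝 0, ∀ y ∈ K, ‖R (t • y.1, t ^ 2 * y.2)‖ ≤ C * |t| ^ k := by
  obtain ⟨C, hC, hbound⟩ := IsBigO.exists_pos hR
  obtain ⟨ε, hε, hball⟩ := Metric.eventually_nhds_iff_ball.1 hbound.bound
  obtain ⟨B, hB, hKB⟩ := hK.exists_pos_norm_le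
  have habs : Tendsto (fun t : ℝ => |t|) (𝓝 0) (𝓝 0) := by
    simpa only [abs_zero] using continuous_abs.tendsto (0 : ℝ)
  refine ⟨C * B ^ k, ?_⟩
  filter_upwards [habs.eventually_lt_const one_pos,
    habs.eventually_lt_const (div_pos hε hB)] with t ht₁ htε y hy
  have hnorm : ‖((t • y.1, t ^ 2 * y.2) : CnR n)‖ ≤ |t| * B :=
    (norm_weighted_dilation_le ht₁.le y).trans
      (mul_le_mul_of_nonneg_left (hKB y hy) (abs_nonneg t))
  calc ‖R (t • y.1, t ^ 2 * y.2)‖ ≤ C * ‖‖((t • y.1, t ^ 2 * y.2) : CnR n)‖ ^ k‖ :=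
        hball _ (mem_ball_zero_iff.2 (hnorm.trans_lt ((lt_div_iff₀ hB).1 htε)))
    _ ≤ C * (|t| * B) ^ k := by
      rw [norm_pow, norm_norm]
      gcongr
    _ = C * B ^ k * |t| ^ k := by ring

theorem VanishesToOrder.isLittleOWt {R : CnR n → ℝ} {k : ℕ}
    (hR : VanishesToOrder (k + 1) R) : IsLittleOWt k R := by
  intro K hK
  obtain ⟨C, hC⟩ := VanishesToOrder.exists_eventually_weighted_le hR hK.isBounded
  rw [Metric.tendstoUniformlyOn_iff]
  intro η hη
  have hsmall : ∀ᶠ t : ℝ in 𝓝 0, C * |t| < η := by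
    have hcont : Continuous fun t : ℝ => C * |t| := by fun_prop
    exact hcont.continuousAt.eventually_lt_const (by simpa using hη)
  filter_upwards [(hC.and hsmall).filter_mono nhdsWithin_le_nhds, self_mem_nhdsWithin]
    with t ⟨hbound, hlt⟩ ht y hy
  have htpos : 0 < |t| ^ k := pow_pos (abs_pos.2 ht) k
  rw [dist_zero_left, norm_div, norm_pow, Real.norm_eq_abs t, div_lt_iff₀ htpos]
  calc ‖R (t • y.1, t ^ 2 * y.2)‖ ≤ C * |t| * |t| ^ k := by
        rw [mul_assoc, ← pow_succ']
        exact hbound y hy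
    _ < η * |t| ^ k := mul_lt_mul_of_pos_right hlt htpos

end LittleO

section LocalInverse

variable {n ℓ : ℕ} {M : Set (Cn1 n)} {p : Cn1 n} {ρ : Cn1 n → ℝ} {T : Cn1 n ≃L[ℂ] Cn1 n}
  {θ : tangentSpaceAt M p →ₗ[ℝ] ℝ} {Γ : Cn1 n → Cn1 n} {φ : CnR n → ℝ}
  {s : Fin n → Fin n → Fin n → Fin n → ℂ}

theorem exists_local_inverse {E : Type*} [NormedAddCommGroup E] [NormedSpace ℂ E]
    [CompleteSpace E] {Γ : E → E} (hΓ : ContDiffAt ℂ 1 Γ 0) {T : E ≃L[ℂ] E}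
    (hT : HasFDerivAt Γ (T : E →L[ℂ] E) 0) :
    ∃ F : OpenPartialHomeomorph E E, Γ 0 ∈ F.source ∧ F (Γ 0) = 0 ∧ F.symm = Γ ∧
      DifferentiableOn ℂ F F.source := by
  let e := hΓ.toOpenPartialHomeomorph Γ hT one_ne_zero
  have h0 : 0 ∈ e.source := hΓ.mem_toOpenPartialHomeomorph_source hT one_ne_zero
  have hdiff : ∀ᶠ x in 𝓝 (Γ 0), DifferentiableAt ℂ e.symm x :=
    ((hΓ.to_localInverse hT one_ne_zero).eventually (by simp)).mono fun x hx =>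
      hx.differentiableAt one_ne_zero
  obtain ⟨U, hUdiff, hU, hU0⟩ := eventually_nhds_iff.1 hdiff
  exact ⟨e.symm.restrOpen U hU, ⟨e.map_source h0, hU0⟩, e.left_inv h0, rfl,
    fun x hx => (hUdiff x hx.2).differentiableWithinAt⟩

theorem IsGraphChart.eventually_mem_image_iff (h : IsGraphChart M p T Γ φ)
    {F : OpenPartialHomeomorph (Cn1 n) (Cn1 n)} (hFp : p ∈ F.source) (hF0 : F p = 0)
    (hF : F.symm = Γ) :
    ∀ᶠ x in 𝓝 0, x ∈ F '' (M ∩ F.source) ↔ graphDefect φ x = 0 := by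
  have h0 : (0 : Cn1 n) ∈ F.target := hF0 ▸ F.map_source hFp
  filter_upwards [h.mem_iff, F.open_target.mem_nhds h0] with x hx hxF
  rw [graphDefect, sub_eq_zero, ← hx, ← hF, Set.inter_comm, F.image_source_inter_eq']
  exact and_iff_right hxF

theorem IsGraphChart.isLocalDefining_image (h : IsGraphChart M p T Γ φ)
    (hφ : VanishesToOrder 2 φ) {F : OpenPartialHomeomorph (Cn1 n) (Cn1 n)} (hFp : p ∈ F.source)
    (hF0 : F p = 0) (hF : F.symm = Γ) :
    IsLocalDefining (F '' (M ∩ F.source)) 0 (graphDefect φ) := by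
  refine .of_eventually (eventually_contDiffAt_graphDefect h.smooth) (fun hzero => ?_)
    (h.eventually_mem_image_iff hFp hF0 hF)
  rw [(hasFDerivAt_graphDefect hφ).fderiv] at hzero
  simpa using DFunLike.congr_fun hzero ((0, Complex.I) : Cn1 n)

theorem I_mul_del_graphDefect (hφ : VanishesToOrder 2 φ) {y : Cn1 n} (hy : y.2.im = 0) :
    Complex.I * del (fun x => (graphDefect φ x : ℂ)) 0 y = ((y.2.re / 2 : ℝ) : ℂ) := by
  have hfderiv := (Complex.ofRealCLM.hasFDerivAt.comp 0 (hasFDerivAt_graphDefect hφ)).fderiv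
  have hdel : fderiv ℝ (fun x => (graphDefect φ x : ℂ)) 0 = _ := hfderiv
  have him : (Complex.I • y).2.im = y.2.re := by simp
  rw [del, hdel]
  simp only [ContinuousLinearMap.comp_apply, Complex.ofRealCLM_apply, Complex.imCLM_apply,
    ContinuousLinearMap.coe_snd', hy, him]
  push_cast
  linear_combination (-(1 / 2) * (y.2.re : ℂ)) * Complex.I_mul_I

/-- The term `R` of the normal form `v = |z|² - s/4 - R` of the graph `v = φ(z, u)`. -/
def normalFormRemainder (ℓ : ℕ) (s : Fin n → Fin n → Fin n → Fin n → ℂ) (φ : CnR n → ℝ)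
    (y : CnR n) : ℝ :=
  normSqRe ℓ y.1 - 1 / 4 * (quartic s y.1).re - φ y

theorem normalForm_eq_graphDefect (hs : IsChernMoserTensor ℓ s) (φ : CnR n → ℝ) :
    normalForm ℓ s (normalFormRemainder ℓ s φ) = fun x => (graphDefect φ x : ℂ) := by
  funext x
  have hre : ((quartic s x.1).re : ℂ) = quartic s x.1 := quartic_eq_re s hs.conj_eq x.1
  rw [normalForm, ← normSqL_eq_re, normalFormRemainder, graphDefect, normSqRe]
  push_cast
  rw [hre]
  ring

theorem VanishesToOrder.of_normalFormRemainder
    (hR : VanishesToOrder 2 (normalFormRemainder ℓ s φ)) : VanishesToOrder 2 φ := by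
  have hquartic : VanishesToOrder 2 fun y : CnR n => 1 / 4 * (quartic s y.1).re :=
    ((vanishesToOrder_quartic_re s).of_le (by norm_num)).const_mul_left _
  refine (((vanishesToOrder_normSqRe_fst ℓ).sub hquartic).sub hR).congr_left fun y => ?_
  rw [normalFormRemainder]
  ring

theorem exists_contDiffOn_normalFormRemainder (hφ : ∀ᶠ y in 𝓝 0, ContDiffAt ℝ ∞ φ y) :
    ∃ V ∈ 𝓝 0, ContDiffOn ℝ ∞ (normalFormRemainder ℓ s φ) V := by
  have hmodel : ContDiff ℝ ∞ fun y : CnR n => normSqRe ℓ y.1 - 1 / 4 * (quartic s y.1).re :=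
    ((contDiff_normSqRe ℓ).comp contDiff_fst).sub (contDiff_const.mul
      (Complex.reCLM.contDiff.comp ((contDiff_quartic s).comp contDiff_fst)))
  exact ⟨_, hφ, fun y hy => (hmodel.contDiffAt.sub hy).contDiffWithinAt⟩

theorem IsGraphChart.contactForm_eq (h : IsGraphChart M p T Γ φ) (hφ : VanishesToOrder 2 φ)
    (hT : IsAdaptedFrame ℓ ρ θ T) (hρ : IsLocalDefining M p ρ) (hp : p ∈ M)
    {F : OpenPartialHomeomorph (Cn1 n) (Cn1 n)} (hFp : p ∈ F.source) (hF0 : F p = 0)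
    (hF : F.symm = Γ) (y : Cn1 n) (hy : y ∈ tangentSpaceAt (F '' (M ∩ F.source)) 0) :
    ∃ hy : fderiv ℝ F.symm 0 y ∈ tangentSpaceAt M p,
      Complex.I * del (fun x => (graphDefect φ x : ℂ)) 0 y = θ ⟨fderiv ℝ F.symm 0 y, hy⟩ := by
  have him : y.2.im = 0 := by
    rw [(h.isLocalDefining_image hφ hFp hF0 hF).mem_tangentSpaceAt ⟨p, ⟨hp, hFp⟩, hF0⟩,
      (hasFDerivAt_graphDefect hφ).fderiv] at hy
    exact hy
  have hfderiv : fderiv ℝ F.symm 0 y = T y := by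
    rw [hF, (h.hasFDerivAt.restrictScalars ℝ).fderiv]
    rfl
  have hTy : T y ∈ tangentSpaceAt M p := by
    rw [hρ.mem_tangentSpaceAt hp, hT.fderiv_apply, him]
  simp only [hfderiv]
  exact ⟨hTy, by rw [hT.contactForm_apply, I_mul_del_graphDefect hφ him]⟩

end LocalInverse

end CRHyp

end

theorem proposition2p1_general (n ℓ : ℕ)
    (M : Set (Cn1 n)) (p : Cn1 n) (hM : ∃ ρ, IsLocalDefining M p ρ) (hp : p ∈ M)
    (θ : tangentSpaceAt M p →ₗ[ℝ] ℝ) (hθ : IsAppropriateContactForm M ℓ p θ) :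
    ∃ (F : OpenPartialHomeomorph (Cn1 n) (Cn1 n))
      (s : Fin n → Fin n → Fin n → Fin n → ℂ) (R : (Fin n → ℂ) × ℝ → ℝ),
      p ∈ F.source ∧ F p = 0 ∧
      DifferentiableOn ℂ F F.source ∧ DifferentiableOn ℂ F.symm F.target ∧
      (∀ᶠ x in 𝓝 (0 : Cn1 n), x ∈ F '' (M ∩ F.source) ↔ normalForm ℓ s R x = 0) ∧
      IsChernMoserTensor ℓ s ∧
      (∀ z, laplacianL ℓ (quartic s) z = 0) ∧
      (∃ V ∈ 𝓝 (0 : (Fin n → ℂ) × ℝ), ContDiffOn ℝ ∞ R V) ∧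
      IsLittleOWt 4 R ∧
      R =o[𝓝 0] (fun y => ‖y‖ ^ 4) ∧
      (∀ y ∈ tangentSpaceAt (F '' (M ∩ F.source)) 0,
        ∃ hy : fderiv ℝ F.symm 0 y ∈ tangentSpaceAt M p,
          Complex.I * del (normalForm ℓ s R) 0 y = (θ ⟨fderiv ℝ F.symm 0 y, hy⟩ : ℂ)) := by
  obtain ⟨ρ, T, hρ, hT⟩ := hθ.exists_isAdaptedFrame hM hp
  obtain ⟨s, Γ, φ, hs, hΓ, hφ⟩ := hT.exists_normal_chart hρ hp
  obtain ⟨F, hFp, hF0, hF, hFdiff⟩ :=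
    exists_local_inverse (hΓ.contDiff.contDiffAt.of_le (by simp)) hΓ.hasFDerivAt
  rw [hΓ.apply_zero] at hFp hF0
  have hR : VanishesToOrder 5 (normalFormRemainder ℓ s φ) := 
    hφ.neg_left.congr_left fun y => neg_sub _ _
  have hφ₂ : VanishesToOrder 2 φ := .of_normalFormRemainder (hR.of_le (by norm_num))
  refine ⟨F, s, normalFormRemainder ℓ s φ, hFp, hF0, hFdiff, ?_, ?_, hs, laplacianL_quartic hs,
    exists_contDiffOn_normalFormRemainder hΓ.smooth, hR.isLittleOWt, hR.isLittleO (by norm_num), ?_⟩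
  · exact hF ▸ (hΓ.contDiff.differentiable (by simp)).differentiableOn
  · simpa only [normalForm_eq_graphDefect hs, Complex.ofReal_eq_zero]
      using hΓ.eventually_mem_image_iff hFp hF0 hF
  · rw [normalForm_eq_graphDefect hs]
    exact hΓ.contactForm_eq hφ₂ hT hρ hp hFp hF0 hF

theorem proposition2p1 (n ℓ : ℕ) (hn : 2 ≤ n) (hℓ : 2 * ℓ ≤ n)
    (M : Set (Cn1 n)) (hM : IsSmoothHypersurface M) (hL : IsLeviNondegenerate M ℓ)
    (p : Cn1 n) (hp : p ∈ M)
    (θ : tangentSpaceAt M p →ₗ[ℝ] ℝ) (hθ : IsAppropriateContactForm M ℓ p θ) :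
    ∃ (F : OpenPartialHomeomorph (Cn1 n) (Cn1 n))
      (s : Fin n → Fin n → Fin n → Fin n → ℂ) (R : (Fin n → ℂ) × ℝ → ℝ),
      p ∈ F.source ∧ F p = 0 ∧
      DifferentiableOn ℂ F F.source ∧ DifferentiableOn ℂ F.symm F.target ∧
      (∀ᶠ x in 𝓝 (0 : Cn1 n), x ∈ F '' (M ∩ F.source) ↔ normalForm ℓ s R x = 0) ∧
      IsChernMoserTensor ℓ s ∧
      (∀ z, laplacianL ℓ (quartic s) z = 0) ∧
      (∃ V ∈ 𝓝 (0 : (Fin n → ℂ) × ℝ), ContDiffOn ℝ ∞ R V) ∧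
      IsLittleOWt 4 R ∧
      R =o[𝓝 0] (fun y => ‖y‖ ^ 4) ∧
      (∀ y ∈ tangentSpaceAt (F '' (M ∩ F.source)) 0,
        ∃ hy : fderiv ℝ F.symm 0 y ∈ tangentSpaceAt M p,
          Complex.I * del (normalForm ℓ s R) 0 y = (θ ⟨fderiv ℝ F.symm 0 y, hy⟩ : ℂ)) :=
  proposition2p1_general n ℓ M p (hM p hp) hp θ hθ
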